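/- Let $n\ge 2$, let $q\in\mathbb{C}\setminus\{0\}$, and choose $\omega\in\mathbb{C}$ with $\omega^{n^2}=q$ and a square root $\omega^{1/2}$ of $\omega$. *Quantum torus.* Let $\Theta_n=\{(a,b,c)\in\mathbb{Z}_{\ge0}^3 : a+b+c=n\}$ and let $V$ be $\Theta_n$ without its corners $(n,0,0),(0,n,0),(0,0,n)$. There is an arrow from $\nu\in V$ to $\nu'\in V$ if $\nu'-\nu\in\{(-1,0,1),(0,1,-1),(1,-1,0)\}$; its weight is $1$ if $\nu$ and $\nu'$ lie on a common side of the triangle (some coordinate vanishes at both) and $2$ otherwise. Let $P_{\nu\nu'}$ be the weight of the arrow from $\nu$ to $\nu'$ if there is one, minus the weight of the arrow from $\nu'$ to $\nu$ if there is one, and $0$ if there is neither. The Fock–Goncharov quantum torus $\mathscr{T}_n^\omega$ is the $\mathbb{C}$-algebra generated by $X_\nu^{\pm1/n}$ $(\nu\in V)$ with the relations $X_\nu^{r/n}X_{\nu'}^{s/n}=\omega^{P_{\nu\nu'}rs}X_{\nu'}^{s/n}X_\nu^{r/n}$ and $X_\nu^{r/n}X_\nu^{-r/n}=1$ for $r,s\in\mathbb{Z}$.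 The Weyl ordering is the linear map $$[-]:\mathbb{C}[X_\nu^{\pm1/n}:\nu\in V]\to\mathscr{T}_n^\omega,\qquad [X_{\nu_1}^{m_1/n}\cdots X_{\nu_k}^{m_k/n}]=(\omega^{1/2})^{-\sum_{a<b}P_{\nu_a\nu_b}m_am_b}\,X_{\nu_1}^{m_1/n}\cdots X_{\nu_k}^{m_k/n}$$ from commutative Laurent polynomials; it is applied to matrices entrywise. *Matrices.* Over a commutative algebra, for $1\le k\le n-1$ and $X, Z$ with chosen invertible $n$-th roots, put $$S^{\mathrm{left}}_k(X)=X^{-\frac{k-1}{n}}\bigl(\mathrm{diag}(\underbrace{X,\dots,X}_{k-1},1,\dots,1)+E_{k,k+1}\bigr),\qquad S^{\mathrm{right}}_k(X)=X^{\frac{k-1}{n}}\bigl(\mathrm{diag}(1,\dots,1,\underbrace{X^{-1},\dots,X^{-1}}_{k-1})+E_{n-k+1,n-k}\bigr),$$ $$S^{\mathrm{edge}}_k(Z)=Z^{-\frac{k}{n}}\,\mathrm{diag}(\underbrace{Z,\dots,Z}_{k},1,\dots,1),$$ where $S^{\mathrm{left}}_1,S^{\mathrm{right}}_1$ do not depend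 on $X$. With products of matrices written from left to right, let $M^{\mathrm{edge}}(Z_1,\dots,Z_{n-1})=S^{\mathrm{edge}}_1(Z_1)\cdots S^{\mathrm{edge}}_{n-1}(Z_{n-1})$ and $$M^{\mathrm{left}}=\prod_{k=n-1,\,n-2,\dots,1}\Bigl(S^{\mathrm{left}}_1\prod_{\ell=2}^{k}S^{\mathrm{left}}_\ell(X_{\ell-1,\,n-k,\,k-\ell+1})\Bigr),\qquad M^{\mathrm{right}}=\prod_{k=n-1,\,n-2,\dots,1}\Bigl(S^{\mathrm{right}}_1\prod_{\ell=2}^{k}S^{\mathrm{right}}_\ell(X_{k-\ell+1,\,n-k,\,\ell-1})\Bigr).$$ Put $Z_j=X_{j,0,n-j}$, $Z'_j=X_{j,n-j,0}$, $Z''_j=X_{0,j,n-j}$. The quantum left and right matrices in $\mathrm{M}_n(\mathscr{T}_n^\omega)$ are $$\mathbf{L}^\omega=[M^{\mathrm{edge}}(Z)\,M^{\mathrm{left}}\,M^{\mathrm{edge}}(Z')],\qquad \mathbf{R}^\omega=[M^{\mathrm{edge}}(Z)\,M^{\mathrm{right}}\,M^{\mathrm{edge}}(Z'')].$$ *Points.*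 For a $\mathbb{C}$-algebra $\mathscr{T}$, a matrix $M\in\mathrm{M}_n(\mathscr{T})$ is a $\mathscr{T}$-point of $\mathrm{SL}_n^q$ if every $2\times2$ submatrix $\begin{pmatrix}a&b\\c&d\end{pmatrix}$ (rows $i<j$, columns $k<m$) satisfies $$ba=qab,\quad dc=qcd,\quad ca=qac,\quad db=qbd,\quad bc=cb,\quad da-ad=(q-q^{-1})bc,$$ and $\mathrm{Det}^q(M)=\sum_{\sigma\in S_n}(-q^{-1})^{\ell(\sigma)}M_{1\sigma(1)}\cdots M_{n\sigma(n)}=1$, where $\ell(\sigma)$ is the number of inversions of $\sigma$. The algebra $\mathrm{SL}_n^q$ is generated by $n^2$ elements $m_{ij}$ subject to exactly these relations for the matrix $(m_{ij})$. **Theorem.** The matrices $\mathbf{L}^\omega$ and $\mathbf{R}^\omega$ are $\mathscr{T}_n^\omega$-points of $\mathrm{SL}_n^q$. Moreover, there is a unique $\mathbb{C}$-algebra homomorphism $\mathrm{SL}_n^q\to\mathscr{T}_n^\omega$ sending each $m_{ij}$ to $\mathbf{L}^\omega_{ij}$, and a unique one sending each $m_{ij}$ to $\mathbf{R}^\omega_{ij}$.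 -/

import Mathlib

noncomputable section

namespace FockGoncharov

/-! ### Quantum tori with `n`-th roots -/

/-- The word `X_v^{m/n}` (`m : ℤ`) in the free algebra on the letters `X_v^{1/n} = (v, true)` and
`X_v^{-1/n} = (v, false)`. -/
def freePow {V : Type} (v : V) : ℤ → FreeAlgebra ℂ (V × Bool)
  | Int.ofNat m => FreeAlgebra.ι ℂ (v, true) ^ m
  | Int.negSucc m => FreeAlgebra.ι ℂ (v, false) ^ (m + 1)

/-- The defining relations of the quantum torus of the Poisson matrix `P`. -/
inductive TorusRel {V : Type} (P : V → V → ℤ) (ω : ℂ) :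
    FreeAlgebra ℂ (V × Bool) → FreeAlgebra ℂ (V × Bool) → Prop
  | comm (v w : V) (r s : ℤ) :
      TorusRel P ω (freePow v r * freePow w s)
        (ω ^ (P v w * r * s) • (freePow w s * freePow v r))
  | inv (v : V) (r : ℤ) : TorusRel P ω (freePow v r * freePow v (-r)) 1

/-- The quantum torus (with `n`-th roots) of the Poisson matrix `P`. -/
abbrev QTorus {V : Type} (P : V → V → ℤ) (ω : ℂ) : Type := RingQuot (TorusRel P ω)

/-- The element `X_v^{m/n}` of the quantum torus. -/
def QTorus.X {V : Type} (P : V → V → ℤ) (ω : ℂ) (v : V) (m : ℤ) : QTorus P ω :=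
  RingQuot.mkAlgHom ℂ (TorusRel P ω) (freePow v m)

/-! ### Weyl ordering -/

/-- A word `X_{v₁}^{m₁/n} ⋯ X_{vₖ}^{mₖ/n}` is the list of the pairs `(vₐ, mₐ)`. This is its exponent
`∑_{a < b} P v_a v_b m_a m_b`. -/
def weylExponent {V : Type} (P : V → V → ℤ) : List (V × ℤ) → ℤ
  | [] => 0
  | x :: w => (w.map fun y => P x.1 y.1 * x.2 * y.2).sum + weylExponent P w

/-- The Weyl ordering of a word. Here `η = ω^{1/2}`, so that
`q^{-(1/2) ∑ P r_a r_b} = η^{-∑ P m_a m_b}` for `r_a = m_a / n` and `q = ω^{n²}`. -/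
def weylWord {V : Type} (P : V → V → ℤ) (ω η : ℂ) (w : List (V × ℤ)) : QTorus P ω :=
  η ^ (-weylExponent P w) • (w.map fun x => QTorus.X P ω x.1 x.2).prod

/-- The commutative Laurent polynomial algebra in the variables `X_v^{1/n}`; the exponent
`m : V →₀ ℤ` stands for the monomial `∏ X_v^{m v / n}`. -/
abbrev Laurent (V : Type) : Type := AddMonoidAlgebra ℂ (V →₀ ℤ)

/-- The Weyl ordering of Laurent polynomials: the linear map that sends a monomial to the Weyl
ordering of a word representing it (the order of the letters is irrelevant by `weylWord_perm`). -/
def weyl {V : Type} (P : V → V → ℤ) (ω η : ℂ) : Laurent V →ₗ[ℂ] QTorus P ω :=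
  Finsupp.linearCombination ℂ
      (fun m : V →₀ ℤ => weylWord P ω η (m.support.toList.map fun v => (v, m v))) ∘ₗ
    (AddMonoidAlgebra.coeffLinearEquiv ℂ).toLinearMap

theorem QTorus.X_mul_X {V : Type} (P : V → V → ℤ) (ω : ℂ) (v w : V) (r s : ℤ) :
    QTorus.X P ω v r * QTorus.X P ω w s
      = ω ^ (P v w * r * s) • (QTorus.X P ω w s * QTorus.X P ω v r) := by
  have h := RingQuot.mkAlgHom_rel ℂ (TorusRel.comm (P := P) (ω := ω) v w r s)
  simpa [QTorus.X] using h

theorem weylExponent_perm_map {V : Type} (P : V → V → ℤ) (x : V × ℤ) {w w' : List (V × ℤ)}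
    (h : w.Perm w') :
    (w.map fun y => P x.1 y.1 * x.2 * y.2).sum = (w'.map fun y => P x.1 y.1 * x.2 * y.2).sum :=
  (h.map _).sum_eq

/-- The Weyl ordering of a word does not depend on the order of its letters. -/
theorem weylWord_perm {V : Type} (P : V → V → ℤ) (hP : ∀ v w, P v w = -P w v) (ω η : ℂ)
    (hη : η ≠ 0) (hω : η ^ 2 = ω) {w w' : List (V × ℤ)} (h : w.Perm w') :
    weylWord P ω η w = weylWord P ω η w' := by
  induction h with
  | nil => rfl
  | cons x h ih =>
    simp only [weylWord, weylExponent, List.map_cons, List.prod_cons] at ih ⊢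
    rw [weylExponent_perm_map P x h, neg_add, neg_add, zpow_add₀ hη, zpow_add₀ hη,
      mul_smul, mul_smul, ← mul_smul_comm, ih, mul_smul_comm]
  | swap x y l =>
    simp only [weylWord, weylExponent, List.map_cons, List.prod_cons, List.sum_cons,
      ← mul_assoc]
    rw [QTorus.X_mul_X P ω y.1 x.1, smul_mul_assoc, smul_smul, ← hω, ← zpow_natCast, ← zpow_mul,
      ← zpow_add₀ hη, hP x.1 y.1]
    congr 2
    push_cast
    ring
  | trans _ _ ih₁ ih₂ => exact ih₁.trans ih₂

/-! ### The quiver of the discrete triangle -/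

/-- The vertices of the discrete `n`-triangle other than its three corners. -/
structure Vertex (n : ℕ) where
  a : ℕ
  b : ℕ
  c : ℕ
  sum_eq : a + b + c = n
  a_ne : a ≠ n
  b_ne : b ≠ n
  c_ne : c ≠ n

/-- There is an arrow of the quiver from `v` to `w`. With `(n,0,0)` at the bottom left, `(0,n,0)` at
the top and `(0,0,n)` at the bottom right, the small upward triangles are oriented
counterclockwise and the small downward ones clockwise. -/
def Arrow {n : ℕ} (v w : Vertex n) : Prop :=
  (w.a + 1 = v.a ∧ w.b = v.b ∧ w.c = v.c + 1) ∨
  (w.a = v.a ∧ w.b = v.b + 1 ∧ w.c + 1 = v.c) ∨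
  (w.a = v.a + 1 ∧ w.b + 1 = v.b ∧ w.c = v.c)

/-- Both vertices lie on one side of the big triangle; arrows between such vertices are dotted. -/
def SameSide {n : ℕ} (v w : Vertex n) : Prop :=
  (v.a = 0 ∧ w.a = 0) ∨ (v.b = 0 ∧ w.b = 0) ∨ (v.c = 0 ∧ w.c = 0)

open Classical in
/-- The Poisson matrix: solid arrows have weight `2`, dotted arrows weight `1`. -/
def poisson (n : ℕ) (v w : Vertex n) : ℤ :=
  if Arrow v w then (if SameSide v w then 1 else 2)
  else if Arrow w v then (if SameSide v w then -1 else -2)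
  else 0

theorem poisson_antisymm (n : ℕ) (v w : Vertex n) : poisson n v w = -poisson n w v := by
  unfold poisson Arrow SameSide
  split_ifs <;> omega

/-- The Fock–Goncharov quantum torus of the discrete `n`-triangle. -/
abbrev FGTorus (n : ℕ) (ω : ℂ) : Type := QTorus (poisson n) ω

/-! ### Classical matrices over a commutative algebra

The argument `x` is the chosen (invertible) `n`-th root `X^{1/n}` of the coordinate `X = x ^ n`.
Rows and columns are indexed by `Fin n`, that is, shifted by one: `i : Fin n` is the row `i + 1`. -/

/-- The `k`-th left-shearing matrix
`X^{-(k-1)/n} (diag(X, …, X, 1, …, 1) + E_{k,k+1})` with `X` appearing `k - 1` times. -/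
def leftShear {A : Type} [CommRing A] (n k : ℕ) (x : Aˣ) : Matrix (Fin n) (Fin n) A :=
  ((x ^ (-((k : ℤ) - 1)) : Aˣ) : A) • Matrix.of fun (i j : Fin n) =>
    if i = j then (if (i : ℕ) + 1 < k then (x : A) ^ n else 1)
    else if (i : ℕ) + 1 = k ∧ (j : ℕ) = k then 1 else 0

/-- The `k`-th right-shearing matrix
`X^{(k-1)/n} (diag(1, …, 1, X⁻¹, …, X⁻¹) + E_{n-k+1,n-k})` with `X⁻¹` appearing `k - 1` times. -/
def rightShear {A : Type} [CommRing A] (n k : ℕ) (x : Aˣ) : Matrix (Fin n) (Fin n) A :=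
  ((x ^ ((k : ℤ) - 1) : Aˣ) : A) • Matrix.of fun (i j : Fin n) =>
    if i = j then (if n < (i : ℕ) + k then ((x⁻¹ : Aˣ) : A) ^ n else 1)
    else if (i : ℕ) + k = n ∧ (j : ℕ) + 1 = i then 1 else 0

/-- The `k`-th edge-shearing matrix `Z^{-k/n} diag(Z, …, Z, 1, …, 1)` with `Z` appearing `k`
times. -/
def edgeShear {A : Type} [CommRing A] (n k : ℕ) (z : Aˣ) : Matrix (Fin n) (Fin n) A :=
  ((z ^ (-(k : ℤ)) : Aˣ) : A) • Matrix.diagonal fun i : Fin n =>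
    if (i : ℕ) < k then (z : A) ^ n else 1

/-- The left matrix: the product over `k = n-1, …, 1`, from left to right, of
`S₁ S₂(X_{1,n-k,k-1}) ⋯ S_k(X_{k-1,n-k,1})`. The first factor does not depend on its argument. -/
def leftMatrix {A : Type} [CommRing A] (n : ℕ) (x : ℕ → ℕ → ℕ → Aˣ) : Matrix (Fin n) (Fin n) A :=
  ((List.Ico 1 n).reverse.map fun k =>
    leftShear n 1 1 *
      ((List.Ico 2 (k + 1)).map fun l => leftShear n l (x (l - 1) (n - k) (k + 1 - l))).prod).prod

/-- The right matrix: the product over `k = n-1, …, 1`, from left to right, of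
`S₁ S₂(X_{k-1,n-k,1}) ⋯ S_k(X_{1,n-k,k-1})`. The first factor does not depend on its argument. -/
def rightMatrix {A : Type} [CommRing A] (n : ℕ) (x : ℕ → ℕ → ℕ → Aˣ) : Matrix (Fin n) (Fin n) A :=
  ((List.Ico 1 n).reverse.map fun k =>
    rightShear n 1 1 *
      ((List.Ico 2 (k + 1)).map fun l => rightShear n l (x (k + 1 - l) (n - k) (l - 1))).prod).prod

/-- The edge matrix `S₁(Z₁) ⋯ S_{n-1}(Z_{n-1})`. -/
def edgeMatrix {A : Type} [CommRing A] (n : ℕ) (z : ℕ → Aˣ) : Matrix (Fin n) (Fin n) A :=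
  ((List.Ico 1 n).map fun l => edgeShear n l (z l)).prod

/-! ### Quantum left and right matrices -/

/-- The generator `X_v^{1/n}` of the Laurent polynomial algebra, as a unit. -/
def coordUnit {V : Type} (v : V) : (Laurent V)ˣ where
  val := AddMonoidAlgebra.single (Finsupp.single v 1) 1
  inv := AddMonoidAlgebra.single (Finsupp.single v (-1)) 1
  val_inv := by
    rw [AddMonoidAlgebra.single_mul_single, ← Finsupp.single_add]
    simp [AddMonoidAlgebra.one_def]
  inv_val := by
    rw [AddMonoidAlgebra.single_mul_single, ← Finsupp.single_add]
    simp [AddMonoidAlgebra.one_def]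

open Classical in
/-- The generator `X_{abc}^{1/n}`. It is only used at vertices `(a, b, c)`; the value `1` elsewhere
is a placeholder. -/
def coord (n a b c : ℕ) : (Laurent (Vertex n))ˣ :=
  if h : a + b + c = n ∧ a ≠ n ∧ b ≠ n ∧ c ≠ n then
    coordUnit ⟨a, b, c, h.1, h.2.1, h.2.2.1, h.2.2.2⟩
  else 1

/-- The quantum left matrix `[M^edge(Z) M^left(X) M^edge(Z')]`, where `Z_j = X_{j,0,n-j}` and
`Z'_j = X_{j,n-j,0}`. -/
def quantumLeft (n : ℕ) (ω η : ℂ) : Matrix (Fin n) (Fin n) (FGTorus n ω) :=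
  (edgeMatrix n (fun j => coord n j 0 (n - j)) * leftMatrix n (coord n) *
    edgeMatrix n (fun j => coord n j (n - j) 0)).map (weyl (poisson n) ω η)

/-- The quantum right matrix `[M^edge(Z) M^right(X) M^edge(Z'')]`, where `Z_j = X_{j,0,n-j}` and
`Z''_j = X_{0,j,n-j}`. -/
def quantumRight (n : ℕ) (ω η : ℂ) : Matrix (Fin n) (Fin n) (FGTorus n ω) :=
  (edgeMatrix n (fun j => coord n j 0 (n - j)) * rightMatrix n (coord n) *
    edgeMatrix n (fun j => coord n 0 j (n - j))).map (weyl (poisson n) ω η)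

/-! ### The quantum special linear group and its points -/

/-- The `2 × 2` matrix with rows `(a, b)` and `(c, d)` is a point of the quantum matrix algebra
`M_2^q`. -/
def IsM2Point {T : Type} [Ring T] [Algebra ℂ T] (q : ℂ) (a b c d : T) : Prop :=
  b * a = q • (a * b) ∧ d * c = q • (c * d) ∧ c * a = q • (a * c) ∧ d * b = q • (b * d) ∧
    b * c = c * b ∧ d * a - a * d = (q - q⁻¹) • (b * c)

/-- Every `2 × 2` submatrix is a point of `M_2^q`. -/
def IsMPoint {T : Type} [Ring T] [Algebra ℂ T] {n : ℕ} (q : ℂ) (M : Matrix (Fin n) (Fin n) T) :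
    Prop :=
  ∀ i j k m : Fin n, i < j → k < m → IsM2Point q (M i k) (M i m) (M j k) (M j m)

/-- The number of inversions (the length) of a permutation. -/
def inversions {n : ℕ} (σ : Equiv.Perm (Fin n)) : ℕ :=
  (Finset.univ.filter fun p : Fin n × Fin n => p.1 < p.2 ∧ σ p.2 < σ p.1).card

/-- The quantum determinant `∑_σ (-q⁻¹)^{ℓ(σ)} M_{1σ(1)} ⋯ M_{nσ(n)}`; for `n = 2` it is
`ad - q⁻¹ bc`. -/
def qdet {T : Type} [Ring T] [Algebra ℂ T] {n : ℕ} (q : ℂ) (M : Matrix (Fin n) (Fin n) T) : T :=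
  ∑ σ : Equiv.Perm (Fin n), (-q⁻¹) ^ inversions σ • (List.ofFn fun i => M i (σ i)).prod

/-- `M` is a `T`-point of the quantum special linear group `SL_n^q`. -/
def IsSLPoint {T : Type} [Ring T] [Algebra ℂ T] {n : ℕ} (q : ℂ) (M : Matrix (Fin n) (Fin n) T) :
    Prop :=
  IsMPoint q M ∧ qdet q M = 1

/-- The matrix of the free generators of the free algebra on `n²` letters. -/
def freeMatrix (n : ℕ) : Matrix (Fin n) (Fin n) (FreeAlgebra ℂ (Fin n × Fin n)) :=
  Matrix.of fun i j => FreeAlgebra.ι ℂ (i, j)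

/-- The defining relations of the algebra `SL_n^q`. -/
inductive SLRel (n : ℕ) (q : ℂ) :
    FreeAlgebra ℂ (Fin n × Fin n) → FreeAlgebra ℂ (Fin n × Fin n) → Prop
  | row₁ (i j k m : Fin n) (hij : i < j) (hkm : k < m) :
      SLRel n q (freeMatrix n i m * freeMatrix n i k) (q • (freeMatrix n i k * freeMatrix n i m))
  | row₂ (i j k m : Fin n) (hij : i < j) (hkm : k < m) :
      SLRel n q (freeMatrix n j m * freeMatrix n j k) (q • (freeMatrix n j k * freeMatrix n j m))
  | col₁ (i j k m : Fin n) (hij : i < j) (hkm : k < m) :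
      SLRel n q (freeMatrix n j k * freeMatrix n i k) (q • (freeMatrix n i k * freeMatrix n j k))
  | col₂ (i j k m : Fin n) (hij : i < j) (hkm : k < m) :
      SLRel n q (freeMatrix n j m * freeMatrix n i m) (q • (freeMatrix n i m * freeMatrix n j m))
  | anti (i j k m : Fin n) (hij : i < j) (hkm : k < m) :
      SLRel n q (freeMatrix n i m * freeMatrix n j k) (freeMatrix n j k * freeMatrix n i m)
  | diag (i j k m : Fin n) (hij : i < j) (hkm : k < m) :
      SLRel n q (freeMatrix n j m * freeMatrix n i k - freeMatrix n i k * freeMatrix n j m)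
        ((q - q⁻¹) • (freeMatrix n i m * freeMatrix n j k))
  | det : SLRel n q (qdet q (freeMatrix n)) 1

/-- The algebra `SL_n^q`. -/
abbrev SLq (n : ℕ) (q : ℂ) : Type := RingQuot (SLRel n q)

/-- The `n²` generators of `SL_n^q`. -/
def SLq.gen (n : ℕ) (q : ℂ) (i j : Fin n) : SLq n q :=
  RingQuot.mkAlgHom ℂ (SLRel n q) (freeMatrix n i j)

end FockGoncharov

end

/-!
In suitable parameters the left matrix is a product of elementary bidiagonal matrices, which makes
its quantization visible. The vertex `(a, b)` with `a, b ≥ 1` carries a canonical pair `u`, `y` of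
`q`-commuting parameters, every vertex carries a central parameter `g`, and each coordinate is a
Laurent monomial in these. The left matrix becomes a product, over these `(a, b)`, of matrices that
differ from the identity only in the block `!![U, U * Y; 0, U⁻¹]` in rows and columns `a`, `a + 1`,
where `U = u ^ n` and `Y = y ^ n`, interleaved with diagonal matrices in the parameters `g`. Each
factor is an upper triangular quantum matrix whose diagonal has product `1`, and entries of
different factors commute. By the RTT form `R M₁ M₂ = M₂ M₁ R` of the relations such a product is
again a quantum matrix, and its quantum determinant is the product of its diagonal, that is, `1`.

The Weyl ordering enters through one property only: it turns a product of monomials into `η` to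
the power of the commutation form times the product of their images. So a polynomial identity
between Weyl-ordered elements depends only on the form on exponents, and the relations carry over
from the parameters to the Fock–Goncharov coordinates once the Poisson matrix is checked to be the
pullback of the canonical form.

The right matrix is the left matrix with rows and columns reversed, evaluated at the inverse
coordinates of the reflected vertices. The reflection negates the Poisson matrix, which corresponds
to the passage from `q` to `q⁻¹` caused by the reversal.
-/

noncomputable section

namespace FockGoncharov

/-! ### Weyl orderings -/

section WeylMap

variable {K W T : Type*} [Field K] [AddCommGroup W] [Ring T] [Algebra K T]

/-- `C` is a Weyl ordering for the bilinear form `B` on the exponents `W`: the images of the Laurent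
monomials multiply as in the group algebra of `W` twisted by `η ^ B`. This is all that the argument
needs to know about the bracket `[-]` and about the quantum torus. -/
structure IsWeylMap (B : W →ₗ[ℤ] W →ₗ[ℤ] ℤ) (η : K) (C : AddMonoidAlgebra K W →ₗ[K] T) :
    Prop where
  map_one : C 1 = 1
  single_mul_single (m m' : W) :
    C (.single m 1) * C (.single m' 1) = η ^ B m m' • C (.single (m + m') 1)

end WeylMap

/-! ### The Weyl ordering of a quantum torus -/

section WeylOrdering

variable {V : Type} {P : V → V → ℤ} {ω η : ℂ}

namespace QTorus

theorem X_zero (v : V) : X P ω v 0 = 1 := by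
  rw [X, show freePow v 0 = 1 from pow_zero _, map_one]

theorem X_mul_X_neg (v : V) (r : ℤ) : X P ω v r * X P ω v (-r) = 1 := by
  simpa only [X, map_mul, map_one] using
    RingQuot.mkAlgHom_rel ℂ (TorusRel.inv (P := P) (ω := ω) v r)

theorem X_natCast (v : V) (m : ℕ) : X P ω v m = X P ω v 1 ^ m := by
  rw [X, X, show freePow v 1 = FreeAlgebra.ι ℂ (v, true) from pow_one _, ← map_pow]
  rfl

/-- The generator `X_v^{1/n}` as a unit, which makes its integral powers available. -/
def unit (P : V → V → ℤ) (ω : ℂ) (v : V) : (QTorus P ω)ˣ where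
  val := X P ω v 1
  inv := X P ω v (-1)
  val_inv := X_mul_X_neg v 1
  inv_val := X_mul_X_neg v (-1)

theorem X_eq_unit_zpow (v : V) (r : ℤ) : X P ω v r = ↑(unit P ω v ^ r) := by
  have natCast_case (m : ℕ) : X P ω v m = ↑(unit P ω v ^ m) := by
    rw [X_natCast, Units.val_pow_eq_pow_val, unit]
  obtain ⟨m, rfl | rfl⟩ := r.eq_nat_or_neg
  · rw [zpow_natCast, natCast_case]
  · rw [zpow_neg, zpow_natCast]
    exact (Units.inv_eq_of_mul_eq_one_right (by rw [← natCast_case, X_mul_X_neg])).symm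

theorem X_add (v : V) (r s : ℤ) : X P ω v (r + s) = X P ω v r * X P ω v s := by
  simp only [X_eq_unit_zpow, zpow_add, Units.val_mul]

end QTorus

/-- The bilinear form on exponents whose Gram matrix in the basis of the variables is `P`. -/
def exponentForm (P : V → V → ℤ) : (V →₀ ℤ) →ₗ[ℤ] (V →₀ ℤ) →ₗ[ℤ] ℤ :=
  Finsupp.linearCombination ℤ fun v => Finsupp.linearCombination ℤ fun w => P v w

theorem exponentForm_single (v w : V) (r s : ℤ) :
    exponentForm P (.single v r) (.single w s) = P v w * r * s := by
  simp only [exponentForm, Finsupp.linearCombination_single, LinearMap.smul_apply, smul_eq_mul]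
  ring

/-- The exponent of the commutative monomial represented by a word. -/
def wordExponent (l : List (V × ℤ)) : V →₀ ℤ := (l.map fun x => Finsupp.single x.1 x.2).sum

theorem wordExponent_cons (x : V × ℤ) (l : List (V × ℤ)) :
    wordExponent (x :: l) = .single x.1 x.2 + wordExponent l := by
  rw [wordExponent, List.map_cons, List.sum_cons, wordExponent]

theorem wordExponent_append (l l' : List (V × ℤ)) :
    wordExponent (l ++ l') = wordExponent l + wordExponent l' := by
  simp only [wordExponent, List.map_append, List.sum_append]

/-- The word that `weyl` chooses to represent a monomial. -/
def canonicalWord (m : V →₀ ℤ) : List (V × ℤ) := m.support.toList.map fun v => (v, m v)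

theorem wordExponent_canonicalWord (m : V →₀ ℤ) : wordExponent (canonicalWord m) = m := by
  simp only [wordExponent, canonicalWord, List.map_map, Function.comp_def]
  rw [Finset.sum_map_toList]
  exact m.sum_single

theorem canonicalWord_perm_cons_erase (m : V →₀ ℤ) {v : V} (hv : v ∈ m.support) :
    (canonicalWord m).Perm ((v, m v) :: canonicalWord (m.erase v)) := by
  classical
  have support_perm : m.support.toList.Perm (v :: (m.erase v).support.toList) := by
    rw [Finsupp.support_erase]
    refine List.perm_of_nodup_nodup_toFinset_eq (Finset.nodup_toList _) ?_ ?_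
    · simp [Finset.nodup_toList]
    · simp [Finset.insert_erase hv]
  refine (support_perm.map fun w => (w, m w)).trans ?_
  rw [List.map_cons, canonicalWord]
  refine .cons _ (.of_eq (List.map_congr_left fun w hw => ?_))
  rw [Finsupp.erase_ne]
  rintro rfl
  simp at hw

theorem sum_map_eq_exponentForm (x : V × ℤ) (l : List (V × ℤ)) :
    (l.map fun y => P x.1 y.1 * x.2 * y.2).sum =
      exponentForm P (.single x.1 x.2) (wordExponent l) := by
  simp only [wordExponent, map_list_sum, List.map_map, Function.comp_def, exponentForm_single]

theorem weylWord_cons (hη : η ≠ 0) (x : V × ℤ) (l : List (V × ℤ)) :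
    weylWord P ω η (x :: l) =
      η ^ (-exponentForm P (.single x.1 x.2) (wordExponent l)) •
        (QTorus.X P ω x.1 x.2 * weylWord P ω η l) := by
  simp only [weylWord, weylExponent, List.map_cons, List.prod_cons]
  rw [sum_map_eq_exponentForm, neg_add, zpow_add₀ hη, mul_smul, mul_smul_comm]

theorem weylWord_mul_weylWord (hη : η ≠ 0) (l l' : List (V × ℤ)) :
    weylWord P ω η l * weylWord P ω η l' =
      η ^ exponentForm P (wordExponent l) (wordExponent l') • weylWord P ω η (l ++ l') := by
  induction l with
  | nil => simp [weylWord, weylExponent, wordExponent]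
  | cons x l ih =>
    rw [List.cons_append, weylWord_cons hη, weylWord_cons hη, smul_mul_assoc, mul_assoc, ih,
      mul_smul_comm, smul_smul, smul_smul, ← zpow_add₀ hη, ← zpow_add₀ hη, wordExponent_append,
      wordExponent_cons]
    congr 2
    simp only [map_add, LinearMap.add_apply]
    ring

theorem weylWord_cons_zero (hη : η ≠ 0) (v : V) (l : List (V × ℤ)) :
    weylWord P ω η ((v, 0) :: l) = weylWord P ω η l := by
  rw [weylWord_cons hη]
  simp [QTorus.X_zero]

theorem weylWord_merge (hP : ∀ v, P v v = 0) (hη : η ≠ 0) (v : V) (r s : ℤ) (l : List (V × ℤ)) :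
    weylWord P ω η ((v, r) :: (v, s) :: l) = weylWord P ω η ((v, r + s) :: l) := by
  rw [weylWord_cons hη, weylWord_cons hη, weylWord_cons hη, QTorus.X_add, mul_smul_comm, smul_smul,
    ← zpow_add₀ hη, mul_assoc]
  congr 2
  simp only [wordExponent_cons, map_add, exponentForm_single, Finsupp.single_add,
    LinearMap.add_apply, hP]
  ring

theorem weylWord_cons_erase (hP : ∀ v w, P v w = -P w v) (hη : η ≠ 0) (hω : η ^ 2 = ω)
    (m : V →₀ ℤ) (v : V) :
    weylWord P ω η ((v, m v) :: canonicalWord (m.erase v)) = weylWord P ω η (canonicalWord m) := by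
  by_cases hv : v ∈ m.support
  · exact (weylWord_perm P hP ω η hη hω (canonicalWord_perm_cons_erase m hv)).symm
  · rw [Finsupp.notMem_support_iff.1 hv, weylWord_cons_zero hη, Finsupp.erase_of_notMem_support hv]

theorem weylWord_cons_canonicalWord (hP : ∀ v w, P v w = -P w v) (hη : η ≠ 0) (hω : η ^ 2 = ω)
    (m : V →₀ ℤ) (v : V) (r : ℤ) :
    weylWord P ω η ((v, r) :: canonicalWord m) =
      weylWord P ω η (canonicalWord (.single v r + m)) := calc
  _ = weylWord P ω η ((v, r) :: (v, m v) :: canonicalWord (m.erase v)) := by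
    rw [weylWord_cons hη, weylWord_cons hη (v, r), weylWord_cons_erase hP hη hω m v,
      wordExponent_canonicalWord, wordExponent_cons, wordExponent_canonicalWord,
      Finsupp.single_add_erase]
  _ = weylWord P ω η ((v, r + m v) :: canonicalWord (m.erase v)) :=
    weylWord_merge (fun v => self_eq_neg.1 (hP v v)) hη v r (m v) _
  _ = _ := by
    rw [← weylWord_cons_erase hP hη hω (.single v r + m) v, Finsupp.erase_add,
      Finsupp.erase_single, zero_add, Finsupp.add_apply, Finsupp.single_eq_same]

theorem weylWord_eq_weylWord_canonicalWord (hP : ∀ v w, P v w = -P w v) (hη : η ≠ 0)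
    (hω : η ^ 2 = ω) (l : List (V × ℤ)) :
    weylWord P ω η l = weylWord P ω η (canonicalWord (wordExponent l)) := by
  induction l with
  | nil => simp [wordExponent, canonicalWord]
  | cons x l ih =>
    rw [wordExponent_cons, ← weylWord_cons_canonicalWord hP hη hω, weylWord_cons hη,
      weylWord_cons hη, ih, wordExponent_canonicalWord]

theorem isWeylMap_weyl (hP : ∀ v w, P v w = -P w v) (hη : η ≠ 0) (hω : η ^ 2 = ω) :
    IsWeylMap (exponentForm P) η (weyl P ω η) := by
  have weyl_single (m : V →₀ ℤ) : weyl P ω η (.single m 1) = weylWord P ω η (canonicalWord m) := by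
    simp [weyl, canonicalWord]
  refine ⟨?_, fun m m' => ?_⟩
  · rw [AddMonoidAlgebra.one_def, weyl_single]
    simp [weylWord, canonicalWord, weylExponent]
  · rw [weyl_single, weyl_single, weyl_single, weylWord_mul_weylWord hη,
      weylWord_eq_weylWord_canonicalWord hP hη hω (_ ++ _), wordExponent_append,
      wordExponent_canonicalWord, wordExponent_canonicalWord]

end WeylOrdering

/-! ### Quantum matrices and the `R`-matrix -/

section QuantumMatrices

open scoped Kronecker

variable {ι K T : Type*} [Field K] [Ring T] [Algebra K T] {q : K}

/-- The entries of `M` satisfy the relations of the algebra of quantum matrices. Unlike `IsMPoint`,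
this lists the relations within a row and within a column once. -/
structure IsQuantumMatrix [LT ι] (q : K) (M : Matrix ι ι T) : Prop where
  row : ∀ i k m, k < m → M i m * M i k = q • (M i k * M i m)
  col : ∀ i j k, i < j → M j k * M i k = q • (M i k * M j k)
  anti : ∀ i j k m, i < j → k < m → M i m * M j k = M j k * M i m
  diag : ∀ i j k m, i < j → k < m →
    M j m * M i k - M i k * M j m = (q - q⁻¹) • (M i m * M j k)

theorem IsQuantumMatrix.isMPoint {T : Type} [Ring T] [Algebra ℂ T] {n : ℕ} {q : ℂ}
    {M : Matrix (Fin n) (Fin n) T} (h : IsQuantumMatrix q M) : IsMPoint q M :=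
  fun i j k m hij hkm =>
    ⟨h.row i k m hkm, h.row j k m hkm, h.col i j k hij, h.col i j m hij, h.anti i j k m hij hkm,
      h.diag i j k m hij hkm⟩

theorem IsQuantumMatrix.submatrix_rev {n : ℕ} {M : Matrix (Fin n) (Fin n) T} (hq : q ≠ 0)
    (h : IsQuantumMatrix q⁻¹ M) : IsQuantumMatrix q (M.submatrix Fin.rev Fin.rev) where
  row i k m hkm := by
    have := h.row i.rev m.rev k.rev (Fin.rev_lt_rev.2 hkm)
    simp only [Matrix.submatrix_apply, this, smul_inv_smul₀ hq]
  col i j k hij := by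
    have := h.col j.rev i.rev k.rev (Fin.rev_lt_rev.2 hij)
    simp only [Matrix.submatrix_apply, this, smul_inv_smul₀ hq]
  anti i j k m hij hkm := by
    have := h.anti j.rev i.rev m.rev k.rev (Fin.rev_lt_rev.2 hij) (Fin.rev_lt_rev.2 hkm)
    simp only [Matrix.submatrix_apply, this]
  diag i j k m hij hkm := by
    have hdiag := h.diag j.rev i.rev m.rev k.rev (Fin.rev_lt_rev.2 hij) (Fin.rev_lt_rev.2 hkm)
    have hanti := h.anti j.rev i.rev m.rev k.rev (Fin.rev_lt_rev.2 hij) (Fin.rev_lt_rev.2 hkm)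
    rw [hanti, inv_inv] at hdiag
    simp only [Matrix.submatrix_apply]
    rw [← neg_sub, hdiag, ← neg_smul, neg_sub]

theorem mul_kronecker_mul_of_commute [Fintype ι] {M N : Matrix ι ι T}
    (h : ∀ i j k l, Commute (M i j) (N k l)) : (M * N) ⊗ₖ (M * N) = M ⊗ₖ M * N ⊗ₖ N := by
  ext ⟨i, j⟩ ⟨k, l⟩
  simp only [Matrix.kronecker_apply, Matrix.mul_apply, Fintype.sum_prod_type, Finset.sum_mul_sum]
  exact Finset.sum_congr rfl fun s _ => Finset.sum_congr rfl fun t _ =>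
    (h j t s k).symm.mul_mul_mul_comm _ _

section RMatrix

variable [LinearOrder ι]

/-- The coefficient at `e_i ⊗ e_j` of the diagonal part of the braided `R`-matrix. The value at
`i = j` is `q - 1` because the flip contributes another `1`. -/
def braidCoeff (q : K) (i j : ι) : K := if i = j then q - 1 else if j < i then q - q⁻¹ else 0

/-- The braided `R`-matrix of `GL_n` with entries in `T`: the flip plus a diagonal matrix. -/
def braidMatrix (ι T : Type*) [LinearOrder ι] [Ring T] [Algebra K T] (q : K) :
    Matrix (ι × ι) (ι × ι) T :=
  .diagonal (fun x => algebraMap K T (braidCoeff q x.1 x.2)) +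
    (Equiv.prodComm ι ι).toPEquiv.toMatrix

variable [Fintype ι]

theorem braidMatrix_mul_apply (M : Matrix ι ι T) (i j k l : ι) :
    (braidMatrix ι T q * M ⊗ₖ M) (i, j) (k, l) =
      braidCoeff q i j • (M i k * M j l) + M j k * M i l := by
  rw [braidMatrix, Matrix.add_mul, Matrix.add_apply, Matrix.diagonal_mul,
    PEquiv.toMatrix_toPEquiv_mul, ← Algebra.smul_def]
  rfl

theorem mul_braidMatrix_apply (M : Matrix ι ι T) (i j k l : ι) :
    (M ⊗ₖ M * braidMatrix ι T q) (i, j) (k, l) =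
      braidCoeff q k l • (M i k * M j l) + M i l * M j k := by
  rw [braidMatrix, Matrix.mul_add, Matrix.add_apply, Matrix.mul_diagonal,
    PEquiv.mul_toMatrix_toPEquiv, ← Algebra.commutes, ← Algebra.smul_def]
  rfl

theorem IsQuantumMatrix.braidMatrix_mul (hq : q ≠ 0) {M : Matrix ι ι T}
    (h : IsQuantumMatrix q M) :
    braidMatrix ι T q * M ⊗ₖ M = M ⊗ₖ M * braidMatrix ι T q := by
  ext ⟨i, j⟩ ⟨k, l⟩
  rw [braidMatrix_mul_apply, mul_braidMatrix_apply]
  rcases lt_trichotomy i j with hij | rfl | hij <;> rcases lt_trichotomy k l with hkl | rfl | hkl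
  · simp [braidCoeff, hij.ne, hkl.ne, hij.not_gt, hkl.not_gt, h.anti i j k l hij hkl]
  · simp [braidCoeff, hij.ne, hij.not_gt, h.col i j k hij, sub_smul]
  · simp [braidCoeff, hij.ne, hkl.ne', hij.not_gt, hkl, ← h.diag i j l k hij hkl]
  · simp [braidCoeff, hkl.ne, hkl.not_gt, h.row i k l hkl, sub_smul]
  · simp [braidCoeff]
  · simp [braidCoeff, hkl.ne', hkl, h.row i l k hkl, sub_smul, inv_smul_smul₀ hq]
  · simp [braidCoeff, hij.ne', hkl.ne, hkl.not_gt, hij, ← h.anti j i k l hij hkl,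
      ← h.diag j i k l hij hkl]
  · simp [braidCoeff, hij.ne', hij, h.col j i k hij, sub_smul, inv_smul_smul₀ hq]
  · simp [braidCoeff, hij.ne', hkl.ne', hij, hkl, h.anti j i l k hij hkl]

theorem isQuantumMatrix_of_braidMatrix_mul {M : Matrix ι ι T}
    (h : braidMatrix ι T q * M ⊗ₖ M = M ⊗ₖ M * braidMatrix ι T q) : IsQuantumMatrix q M := by
  have rtt (i j k l : ι) : braidCoeff q i j • (M i k * M j l) + M j k * M i l =
      braidCoeff q k l • (M i k * M j l) + M i l * M j k := by
    rw [← braidMatrix_mul_apply, h, mul_braidMatrix_apply]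
  refine ⟨fun i k m hkm => ?_, fun i j k hij => ?_, fun i j k m hij hkm => ?_,
    fun i j k m hij hkm => ?_⟩
  · simpa [braidCoeff, hkm.ne, hkm.not_gt, sub_smul] using (rtt i i k m).symm
  · simpa [braidCoeff, hij.ne, hij.not_gt, sub_smul] using rtt i j k k
  · simpa [braidCoeff, hij.ne, hij.not_gt, hkm.ne, hkm.not_gt] using (rtt i j k m).symm
  · simpa [braidCoeff, hij.ne, hkm.ne', hij.not_gt, hkm, sub_eq_iff_eq_add] using rtt i j m k

theorem IsQuantumMatrix.mul {M N : Matrix ι ι T} (hq : q ≠ 0) (hM : IsQuantumMatrix q M)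
    (hN : IsQuantumMatrix q N) (h : ∀ i j k l, Commute (M i j) (N k l)) :
    IsQuantumMatrix q (M * N) :=
  isQuantumMatrix_of_braidMatrix_mul <| by
    rw [mul_kronecker_mul_of_commute h, ← Matrix.mul_assoc, hM.braidMatrix_mul hq,
      Matrix.mul_assoc, hN.braidMatrix_mul hq, Matrix.mul_assoc]

end RMatrix

end QuantumMatrices

/-! ### Triangular points of `SL_n^q` -/

theorem prod_map_mul_of_pairwise_commute {M ι : Type*} [Monoid M] (f g : ι → M) (l : List ι)
    (h : l.Pairwise fun i j => Commute (g i) (f j)) :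
    (l.map fun i => f i * g i).prod = (l.map f).prod * (l.map g).prod := by
  induction l with
  | nil => simp
  | cons a l ih =>
    rw [List.pairwise_cons] at h
    have hcomm : Commute (g a) (l.map f).prod :=
      Commute.list_prod_right _ _ (List.forall_mem_map.2 h.1)
    simp only [List.map_cons, List.prod_cons, ih h.2]
    exact (hcomm.symm.mul_mul_mul_comm _ _).symm

section BorelPoints

variable {n : ℕ}

theorem diag_mul_of_blockTriangular {R : Type*} [Semiring R] {M N : Matrix (Fin n) (Fin n) R}
    (hM : M.BlockTriangular id) (hN : N.BlockTriangular id) (i : Fin n) :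
    (M * N) i i = M i i * N i i := by
  rw [Matrix.mul_apply]
  refine Fintype.sum_eq_single i fun j hj => ?_
  rcases hj.lt_or_gt with h | h
  · rw [hM h, zero_mul]
  · rw [hN h, mul_zero]

section

variable {K T : Type*} [Field K] [Ring T] [Algebra K T] {q : K}

/-- A quantum matrix that is upper triangular with diagonal entries of product `1`, that is, a point
of the quantum Borel subgroup of `SL_n^q`. The quantum determinant is then automatically `1`. -/
structure IsBorelPoint (q : K) (M : Matrix (Fin n) (Fin n) T) : Prop where
  isQuantumMatrix : IsQuantumMatrix q M
  blockTriangular : M.BlockTriangular id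
  prod_diag : (List.ofFn fun i => M i i).prod = 1

namespace IsBorelPoint

theorem one : IsBorelPoint q (1 : Matrix (Fin n) (Fin n) T) where
  isQuantumMatrix := by
    refine ⟨fun i k m hkm => ?_, fun i j k hij => ?_, fun i j k m hij hkm => ?_,
      fun i j k m hij hkm => ?_⟩ <;> simp only [Matrix.one_apply] <;> split_ifs <;>
      first | omega | simp
  blockTriangular := Matrix.blockTriangular_one
  prod_diag := by simp

theorem mul {M N : Matrix (Fin n) (Fin n) T} (hq : q ≠ 0) (hM : IsBorelPoint q M)
    (hN : IsBorelPoint q N) (h : ∀ i j k l, Commute (M i j) (N k l)) :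
    IsBorelPoint q (M * N) where
  isQuantumMatrix := hM.isQuantumMatrix.mul hq hN.isQuantumMatrix h
  blockTriangular := hM.blockTriangular.mul hN.blockTriangular
  prod_diag := by
    have hM' := hM.prod_diag
    have hN' := hN.prod_diag
    simp only [diag_mul_of_blockTriangular hM.blockTriangular hN.blockTriangular,
      List.ofFn_eq_map] at hM' hN' ⊢
    rw [prod_map_mul_of_pairwise_commute, hM', hN', one_mul]
    exact List.pairwise_of_forall fun i j => (h j j i i).symm

theorem commute_diag {M : Matrix (Fin n) (Fin n) T} (hM : IsBorelPoint q M) (i j : Fin n) :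
    Commute (M i i) (M j j) := by
  have commute_of_lt {i j : Fin n} (hij : i < j) : Commute (M i i) (M j j) := by
    have := hM.isQuantumMatrix.diag i j i j hij hij
    rw [hM.blockTriangular hij, mul_zero, smul_zero, sub_eq_zero] at this
    exact this.symm
  rcases lt_trichotomy i j with h | rfl | h
  · exact commute_of_lt h
  · exact .refl _
  · exact (commute_of_lt h).symm

theorem of_linearMap {T' : Type*} [Ring T'] [Algebra K T'] (Φ : T →ₗ[K] T')
    {M : Matrix (Fin n) (Fin n) T} {N : Matrix (Fin n) (Fin n) T'}
    (hΦ : ∀ l : List (Fin n × Fin n),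
      Φ (l.map fun p => M p.1 p.2).prod = (l.map fun p => N p.1 p.2).prod)
    (hM : IsBorelPoint q M) : IsBorelPoint q N := by
  have map_entry (i j) : Φ (M i j) = N i j := by simpa using hΦ [(i, j)]
  have map_mul (i j k l) : Φ (M i j * M k l) = N i j * N k l := by
    simpa using hΦ [(i, j), (k, l)]
  refine ⟨⟨fun i k m hkm => ?_, fun i j k hij => ?_, fun i j k m hij hkm => ?_,
    fun i j k m hij hkm => ?_⟩, fun i j hij => ?_, ?_⟩
  · rw [← map_mul, hM.isQuantumMatrix.row i k m hkm, map_smul, map_mul]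
  · rw [← map_mul, hM.isQuantumMatrix.col i j k hij, map_smul, map_mul]
  · rw [← map_mul, hM.isQuantumMatrix.anti i j k m hij hkm, map_mul]
  · rw [← map_mul, ← map_mul, ← map_sub, hM.isQuantumMatrix.diag i j k m hij hkm, map_smul, map_mul]
  · rw [← map_entry, hM.blockTriangular hij, map_zero]
  · have map_diag := hΦ (List.ofFn fun i => (i, i))
    have map_one := hΦ []
    simp only [List.map_ofFn, Function.comp_def, List.map_nil, List.prod_nil] at map_diag map_one
    rw [← map_diag, hM.prod_diag, map_one]

end IsBorelPoint

end

section QuantumDeterminant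

variable {T T' : Type} [Ring T] [Algebra ℂ T] [Ring T'] [Algebra ℂ T'] {q : ℂ}

theorem qdet_eq_prod_diag {M : Matrix (Fin n) (Fin n) T}
    (h : ∀ σ : Equiv.Perm (Fin n), σ ≠ 1 → ∃ i, M i (σ i) = 0) :
    qdet q M = (List.ofFn fun i => M i i).prod := by
  have inversions_one : inversions (1 : Equiv.Perm (Fin n)) = 0 := by
    rw [inversions, Finset.card_eq_zero, Finset.filter_eq_empty_iff]
    exact fun p _ hp => lt_asymm hp.1 hp.2
  rw [qdet, Fintype.sum_eq_single 1 fun σ hσ => ?_]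
  · simp only [inversions_one, pow_zero, one_smul, Equiv.Perm.one_apply]
  · obtain ⟨i, hi⟩ := h σ hσ
    rw [List.prod_eq_zero (List.mem_ofFn.2 ⟨i, hi⟩), smul_zero]

theorem exists_apply_lt_of_ne_one {σ : Equiv.Perm (Fin n)} (hσ : σ ≠ 1) : ∃ i, σ i < i := by
  by_contra! h
  have sum_eq : ∑ i : Fin n, (i : ℕ) = ∑ i, (σ i : ℕ) :=
    (Equiv.sum_comp σ fun i => (i : ℕ)).symm
  rw [Finset.sum_eq_sum_iff_of_le fun i _ => Fin.le_def.1 (h i)] at sum_eq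
  exact hσ (Equiv.ext fun i => Fin.ext (sum_eq i (Finset.mem_univ i)).symm)

theorem exists_lt_apply_of_ne_one {σ : Equiv.Perm (Fin n)} (hσ : σ ≠ 1) : ∃ i, i < σ i := by
  obtain ⟨i, hi⟩ := exists_apply_lt_of_ne_one (inv_ne_one.2 hσ)
  exact ⟨σ⁻¹ i, by simpa using hi⟩

theorem IsBorelPoint.isSLPoint {M : Matrix (Fin n) (Fin n) T} (h : IsBorelPoint q M) :
    IsSLPoint q M := by
  refine ⟨h.isQuantumMatrix.isMPoint, ?_⟩
  rw [qdet_eq_prod_diag fun σ hσ => ?_, h.prod_diag]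
  exact (exists_apply_lt_of_ne_one hσ).imp fun i hi => h.blockTriangular hi

theorem IsBorelPoint.isSLPoint_submatrix_rev {M : Matrix (Fin n) (Fin n) T} (hq : q ≠ 0)
    (h : IsBorelPoint q⁻¹ M) : IsSLPoint q (M.submatrix Fin.rev Fin.rev) := by
  refine ⟨(h.isQuantumMatrix.submatrix_rev hq).isMPoint, ?_⟩
  rw [qdet_eq_prod_diag fun σ hσ => ?_]
  · have diag_perm : (List.ofFn fun i : Fin n => M i i).Perm
        (List.ofFn fun i => (M.submatrix Fin.rev Fin.rev) i i) :=
      (Equiv.Perm.ofFn_comp_perm Fin.revPerm fun i => M i i).symm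
    rw [← diag_perm.prod_eq' (List.pairwise_ofFn.2 fun i j _ => h.commute_diag i j), h.prod_diag]
  · exact (exists_lt_apply_of_ne_one hσ).imp fun i hi => h.blockTriangular (Fin.rev_lt_rev.2 hi)

/-! ### The universal property of `SL_n^q` -/

theorem map_qdet (φ : T →ₐ[ℂ] T') (M : Matrix (Fin n) (Fin n) T) :
    φ (qdet q M) = qdet q (M.map φ) := by
  simp [qdet, map_list_prod, List.map_ofFn, Function.comp_def]

theorem IsSLPoint.existsUnique_algHom {M : Matrix (Fin n) (Fin n) T} (h : IsSLPoint q M) :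
    ∃! φ : SLq n q →ₐ[ℂ] T, ∀ i j, φ (SLq.gen n q i j) = M i j := by
  let f : FreeAlgebra ℂ (Fin n × Fin n) →ₐ[ℂ] T := FreeAlgebra.lift ℂ fun x => M x.1 x.2
  have hf (i j) : f (freeMatrix n i j) = M i j := FreeAlgebra.lift_ι_apply _ _
  have hrel ⦃x y⦄ (hxy : SLRel n q x y) : f x = f y := by
    cases hxy with
    | row₁ i j k m hij hkm => simpa [hf] using (h.1 i j k m hij hkm).1
    | row₂ i j k m hij hkm => simpa [hf] using (h.1 i j k m hij hkm).2.1
    | col₁ i j k m hij hkm => simpa [hf] using (h.1 i j k m hij hkm).2.2.1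
    | col₂ i j k m hij hkm => simpa [hf] using (h.1 i j k m hij hkm).2.2.2.1
    | anti i j k m hij hkm => simpa [hf] using (h.1 i j k m hij hkm).2.2.2.2.1
    | diag i j k m hij hkm => simpa [hf] using (h.1 i j k m hij hkm).2.2.2.2.2
    | det =>
      rw [map_qdet, map_one, ← h.2]
      congr 1
      exact Matrix.ext hf
  refine ⟨RingQuot.liftAlgHom ℂ ⟨f, hrel⟩, fun i j => ?_, fun φ hφ => ?_⟩
  · rw [SLq.gen, RingQuot.liftAlgHom_mkAlgHom_apply, hf]
  · refine RingQuot.ringQuot_ext' _ _ _ (FreeAlgebra.hom_ext (funext fun x => ?_))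
    have hφx := hφ x.1 x.2
    simp only [SLq.gen, freeMatrix, Matrix.of_apply] at hφx
    simp [hφx, f]

end QuantumDeterminant

end BorelPoints

/-! ### Laurent polynomials with orthogonal exponents -/

section SupportedIn

variable {K W : Type*} [CommSemiring K] [AddCommGroup W] {S S' : AddSubgroup W}

variable (K) in
/-- The Laurent polynomials with exponents in a subgroup. -/
def supportedIn (S : AddSubgroup W) : Subalgebra K (AddMonoidAlgebra K W) :=
  (AddMonoidAlgebra.mapDomainAlgHom K K S.subtype).range

theorem single_mem_supportedIn {m : W} (hm : m ∈ S) (c : K) :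
    AddMonoidAlgebra.single m c ∈ supportedIn K S :=
  ⟨.single ⟨m, hm⟩ c, AddMonoidAlgebra.mapDomain_single ..⟩

theorem supportedIn_induction {p : AddMonoidAlgebra K W → Prop} (zero : p 0)
    (add : ∀ f g, p f → p g → p (f + g)) (single : ∀ m ∈ S, ∀ c, p (.single m c))
    {f : AddMonoidAlgebra K W} (hf : f ∈ supportedIn K S) : p f := by
  obtain ⟨f, rfl⟩ := hf
  induction f using AddMonoidAlgebra.induction_linear with
  | zero => simpa using zero
  | add f g hf hg => rw [map_add]; exact add _ _ hf hg
  | single m c => simpa using single m m.2 c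

theorem supportedIn_mono (h : S ≤ S') : supportedIn K S ≤ supportedIn K S' := fun _ hf =>
  supportedIn_induction (zero_mem _) (fun _ _ => add_mem)
    (fun _ hm c => single_mem_supportedIn (h hm) c) hf

end SupportedIn

theorem map_single_eq_smul {K W T : Type*} [CommSemiring K] [AddCommMonoid T] [Module K T]
    (C : AddMonoidAlgebra K W →ₗ[K] T) (m : W) (c : K) : C (.single m c) = c • C (.single m 1) := by
  rw [← map_smul, AddMonoidAlgebra.smul_single, smul_eq_mul, mul_one]

namespace IsWeylMap

variable {K W T : Type*} [Field K] [AddCommGroup W] [Ring T] [Algebra K T]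
  {B : W →ₗ[ℤ] W →ₗ[ℤ] ℤ} {η : K} {C : AddMonoidAlgebra K W →ₗ[K] T}

theorem map_mul (hC : IsWeylMap B η C) {S S' : AddSubgroup W} (h : ∀ x ∈ S, ∀ y ∈ S', B x y = 0)
    {f g : AddMonoidAlgebra K W} (hf : f ∈ supportedIn K S) (hg : g ∈ supportedIn K S') :
    C (f * g) = C f * C g := by
  refine supportedIn_induction (p := fun f => C (f * g) = C f * C g) (by simp)
    (fun f₁ f₂ h₁ h₂ => by simp only [add_mul, map_add, h₁, h₂]) (fun m hm c => ?_) hf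
  refine supportedIn_induction (p := fun g => C (.single m c * g) = C (.single m c) * C g) (by simp)
    (fun g₁ g₂ h₁ h₂ => by simp only [mul_add, map_add, h₁, h₂]) (fun m' hm' c' => ?_) hg
  rw [AddMonoidAlgebra.single_mul_single, map_single_eq_smul, map_single_eq_smul C m,
    map_single_eq_smul C m', smul_mul_smul_comm, hC.single_mul_single, h m hm m' hm', zpow_zero,
    one_smul]

theorem commute (hC : IsWeylMap B η C) (hB : B.IsAlt) {S S' : AddSubgroup W}
    (h : ∀ x ∈ S, ∀ y ∈ S', B x y = 0) {f g : AddMonoidAlgebra K W} (hf : f ∈ supportedIn K S)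
    (hg : g ∈ supportedIn K S') : Commute (C f) (C g) := by
  rw [Commute, SemiconjBy, ← hC.map_mul h hf hg, mul_comm f,
    hC.map_mul (fun y hy x hx => hB.isRefl _ _ (h x hx y hy)) hg hf]

theorem single_mul_single_comm (hC : IsWeylMap B η C) (hη : η ≠ 0) (hB : B.IsAlt) (m m' : W) :
    C (.single m 1) * C (.single m' 1) =
      η ^ (2 * B m m') • (C (.single m' 1) * C (.single m 1)) := by
  rw [hC.single_mul_single, hC.single_mul_single, smul_smul, ← zpow_add₀ hη, ← hB.neg m m',
    add_comm m', two_mul, add_neg_cancel_right]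

theorem list_prod_single (hC : IsWeylMap B η C) {ι : Type*} (δ : ι → W)
    (h : ∀ i j, B (δ i) (δ j) = 0) (l : List ι) :
    (l.map fun i => C (.single (δ i) 1)).prod = C (.single (l.map δ).sum 1) := by
  induction l with
  | nil => exact hC.map_one.symm
  | cons i l ih =>
    have hi : B (δ i) (l.map δ).sum = 0 := by
      rw [map_list_sum, List.map_map]
      exact List.sum_eq_zero (List.forall_mem_map.2 fun j _ => h i j)
    rw [List.map_cons, List.prod_cons, ih, hC.single_mul_single, hi, zpow_zero, one_smul,
      List.map_cons, List.sum_cons]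

end IsWeylMap

/-! ### Products of matrices with orthogonal exponents -/

section WeylPoints

variable {K W T : Type*} [Field K] [AddCommGroup W] [Ring T] [Algebra K T]
  {B : W →ₗ[ℤ] W →ₗ[ℤ] ℤ} {η : K} {C : AddMonoidAlgebra K W →ₗ[K] T} {n : ℕ} {q : K}

/-- A matrix of Laurent polynomials with exponents in `S` whose Weyl ordering is a Borel point.
Recording `S` makes it possible to see when two such points commute. -/
structure IsWeylPoint (C : AddMonoidAlgebra K W →ₗ[K] T) (q : K) (S : AddSubgroup W)
    (M : Matrix (Fin n) (Fin n) (AddMonoidAlgebra K W)) : Prop where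
  mem_supportedIn : ∀ i j, M i j ∈ supportedIn K S
  isBorelPoint : IsBorelPoint q (M.map C)

namespace IsWeylPoint

theorem mono {S S' : AddSubgroup W} {M : Matrix (Fin n) (Fin n) (AddMonoidAlgebra K W)}
    (h : IsWeylPoint C q S M) (hS : S ≤ S') : IsWeylPoint C q S' M :=
  ⟨fun i j => supportedIn_mono hS (h.mem_supportedIn i j), h.isBorelPoint⟩

theorem one (hC : IsWeylMap B η C) (S : AddSubgroup W) :
    IsWeylPoint C q S (1 : Matrix (Fin n) (Fin n) (AddMonoidAlgebra K W)) where
  mem_supportedIn i j := by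
    rw [Matrix.one_apply]
    split_ifs
    exacts [one_mem _, zero_mem _]
  isBorelPoint := by
    rw [Matrix.map_one _ (map_zero C) hC.map_one]
    exact .one

theorem mul (hC : IsWeylMap B η C) (hB : B.IsAlt) (hq : q ≠ 0) {S S' : AddSubgroup W}
    {M N : Matrix (Fin n) (Fin n) (AddMonoidAlgebra K W)} (h : ∀ x ∈ S, ∀ y ∈ S', B x y = 0)
    (hM : IsWeylPoint C q S M) (hN : IsWeylPoint C q S' N) :
    IsWeylPoint C q (S ⊔ S') (M * N) where
  mem_supportedIn i j := by
    rw [Matrix.mul_apply]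
    exact sum_mem fun k _ => mul_mem (supportedIn_mono le_sup_left (hM.mem_supportedIn i k))
      (supportedIn_mono le_sup_right (hN.mem_supportedIn k j))
  isBorelPoint := by
    have map_mul : (M * N).map C = M.map C * N.map C := by
      ext1 i j
      simp only [Matrix.map_apply, Matrix.mul_apply, map_sum]
      exact Finset.sum_congr rfl fun k _ =>
        hC.map_mul h (hM.mem_supportedIn i k) (hN.mem_supportedIn k j)
    rw [map_mul]
    exact hM.isBorelPoint.mul hq hN.isBorelPoint fun i j k l =>
      hC.commute hB h (hM.mem_supportedIn i j) (hN.mem_supportedIn k l)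

theorem list_prod (hC : IsWeylMap B η C) (hB : B.IsAlt) (hq : q ≠ 0) {ι : Type*}
    (S : ι → AddSubgroup W) (M : ι → Matrix (Fin n) (Fin n) (AddMonoidAlgebra K W)) (l : List ι)
    (hM : ∀ i ∈ l, IsWeylPoint C q (S i) (M i))
    (hl : l.Pairwise fun i j => ∀ x ∈ S i, ∀ y ∈ S j, B x y = 0) :
    IsWeylPoint C q (⨆ i ∈ l, S i) (l.map M).prod := by
  induction l with
  | nil => exact one hC _
  | cons i l ih =>
    rw [List.pairwise_cons] at hl
    rw [List.forall_mem_cons] at hM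
    have orthogonal : ∀ x ∈ S i, ∀ y ∈ ⨆ j ∈ l, S j, B x y = 0 := fun x hx y hy => by
      have hle : ⨆ j ∈ l, S j ≤ (B x).toAddMonoidHom.ker :=
        iSup₂_le fun j hj y hy => hl.1 j hj x hx y hy
      exact hle hy
    simpa only [List.map_cons, List.prod_cons, List.mem_cons, iSup_or, iSup_sup_eq,
      iSup_iSup_eq_left] using mul hC hB hq orthogonal hM.1 (ih hM.2 hl.2)

end IsWeylPoint

/-- An upper triangular matrix with diagonal `D` whose only other entry is `E`, in row `a` and
column `a + 1` when rows and columns are counted from `1`. -/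
def bidiagonal {R : Type*} [Zero R] (a : ℕ) (D : Fin n → R) (E : R) : Matrix (Fin n) (Fin n) R :=
  Matrix.of fun i j => if i = j then D i else if (i : ℕ) + 1 = a ∧ (j : ℕ) = a then E else 0

theorem isQuantumMatrix_bidiagonal (a : ℕ) (D : Fin n → T) (E : T)
    (hD : ∀ i j, Commute (D i) (D j))
    (hrow : ∀ i : Fin n, (i : ℕ) + 1 = a → E * D i = q • (D i * E))
    (hcol : ∀ i : Fin n, (i : ℕ) = a → D i * E = q • (E * D i))
    (hE : ∀ i : Fin n, (i : ℕ) + 1 ≠ a → (i : ℕ) ≠ a → Commute E (D i)) :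
    IsQuantumMatrix q (bidiagonal a D E) where
  row i k m hkm := by
    simp only [bidiagonal, Matrix.of_apply]
    split_ifs
    any_goals first | omega | simp
    exact hrow i (by omega)
  col i j k hij := by
    simp only [bidiagonal, Matrix.of_apply]
    split_ifs
    any_goals first | omega | simp
    exact hcol j (by omega)
  anti i j k m hij hkm := by
    simp only [bidiagonal, Matrix.of_apply]
    split_ifs <;> first | omega | simp
  diag i j k m hij hkm := by
    have anti_eq_zero : bidiagonal a D E i m * bidiagonal a D E j k = 0 := by
      simp only [bidiagonal, Matrix.of_apply]
      split_ifs <;> first | omega | simp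
    rw [anti_eq_zero, smul_zero, sub_eq_zero]
    simp only [bidiagonal, Matrix.of_apply]
    split_ifs
    any_goals first | omega | simp only [mul_zero, zero_mul]
    · exact hD j i
    · exact (hE j (by omega) (by omega)).symm
    · exact hE i (by omega) (by omega)

theorem isWeylPoint_bidiagonal (hC : IsWeylMap B η C) (hη : η ≠ 0) (hB : B.IsAlt)
    {S : AddSubgroup W} (a : ℕ) (δ : Fin n → W) (ε : W) (hδS : ∀ i, δ i ∈ S) (hεS : ε ∈ S)
    (hδ : ∀ i j, B (δ i) (δ j) = 0) (hsum : ∑ i, δ i = 0) {c : ℤ} (hc : η ^ (2 * c) = q)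
    (hε : ∀ i : Fin n, B ε (δ i) =
      c * ((if (i : ℕ) + 1 = a then 1 else 0) - (if (i : ℕ) = a then 1 else 0))) :
    IsWeylPoint C q S (bidiagonal a (fun i => .single (δ i) 1) (.single ε 1)) where
  mem_supportedIn i j := by
    simp only [bidiagonal, Matrix.of_apply]
    split_ifs
    exacts [single_mem_supportedIn (hδS i) 1, single_mem_supportedIn hεS 1, zero_mem _]
  isBorelPoint := by
    have map_bidiagonal : (bidiagonal a (fun i => .single (δ i) (1 : K)) (.single ε 1)).map C =
        bidiagonal a (fun i => C (.single (δ i) 1)) (C (.single ε 1)) := by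
      ext1 i j
      simp only [Matrix.map_apply, bidiagonal, Matrix.of_apply, apply_ite C, map_zero]
    rw [map_bidiagonal]
    refine ⟨isQuantumMatrix_bidiagonal a _ _ (fun i j => ?_) (fun i hi => ?_) (fun i hi => ?_)
      fun i hi hi' => ?_, fun i j (hij : j < i) => ?_, ?_⟩
    · rw [Commute, SemiconjBy, hC.single_mul_single_comm hη hB, hδ, mul_zero, zpow_zero, one_smul]
    · rw [hC.single_mul_single_comm hη hB, hε, if_pos hi, if_neg (by omega), sub_zero, mul_one, hc]
    · rw [hC.single_mul_single_comm hη hB, ← hB.neg, hε, if_neg (by omega), if_pos hi, zero_sub,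
        mul_neg_one, neg_neg, hc]
    · rw [Commute, SemiconjBy, hC.single_mul_single_comm hη hB, hε, if_neg hi, if_neg hi', sub_zero,
        mul_zero, mul_zero, zpow_zero, one_smul]
    · rw [bidiagonal, Matrix.of_apply, if_neg hij.ne', if_neg (by omega)]
    · simp only [bidiagonal, Matrix.of_apply, if_true]
      rw [List.ofFn_eq_map, hC.list_prod_single δ hδ, ← List.ofFn_eq_map, List.sum_ofFn, hsum,
        ← AddMonoidAlgebra.one_def, hC.map_one]

end WeylPoints

/-! ### Regular representation and transfer -/

section Twist

variable {K W : Type*} [Field K] [AddCommGroup W]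

/-- The regular representation of the group algebra twisted by `η ^ B`: the monomial `m` sends
`k` to `η ^ B m k • (m + k)`. It is the model in which relations between exponents are checked. -/
def twist (B : W →ₗ[ℤ] W →ₗ[ℤ] ℤ) (η : K) :
    AddMonoidAlgebra K W →ₗ[K] Module.End K (AddMonoidAlgebra K W) :=
  (AddMonoidAlgebra.basis W K).constr K fun m =>
    (AddMonoidAlgebra.basis W K).constr K fun k => η ^ B m k • .single (m + k) 1

variable {B : W →ₗ[ℤ] W →ₗ[ℤ] ℤ} {η : K}

theorem twist_single_single (m k : W) :
    twist B η (.single m 1) (.single k 1) = η ^ B m k • .single (m + k) 1 := by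
  simp only [twist, ← AddMonoidAlgebra.basis_apply, Module.Basis.constr_basis]

theorem isWeylMap_twist (hη : η ≠ 0) : IsWeylMap B η (twist B η) where
  map_one := (AddMonoidAlgebra.basis W K).ext fun k => by
    rw [AddMonoidAlgebra.basis_apply, AddMonoidAlgebra.one_def, twist_single_single, map_zero,
      LinearMap.zero_apply, zpow_zero, one_smul, zero_add, Module.End.one_apply]
  single_mul_single m m' := (AddMonoidAlgebra.basis W K).ext fun k => by
    simp only [AddMonoidAlgebra.basis_apply, Module.End.mul_apply, LinearMap.smul_apply,
      twist_single_single, map_smul, smul_smul, map_add, LinearMap.add_apply, zpow_add₀ hη,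
      add_assoc, mul_comm, mul_assoc]

theorem IsWeylMap.map_twist {T : Type*} [Ring T] [Algebra K T] {C : AddMonoidAlgebra K W →ₗ[K] T}
    (hC : IsWeylMap B η C) (f h : AddMonoidAlgebra K W) : C (twist B η f h) = C f * C h := by
  have bilinear : (twist B η).compr₂ C = (LinearMap.mul K T).compl₁₂ C C :=
    (AddMonoidAlgebra.basis W K).ext fun m => (AddMonoidAlgebra.basis W K).ext fun k => by
      simp only [AddMonoidAlgebra.basis_apply, LinearMap.compr₂_apply, twist_single_single,
        map_smul, LinearMap.compl₁₂_apply, LinearMap.mul_apply', hC.single_mul_single]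
  exact LinearMap.congr_fun₂ bilinear f h

variable {G : Type*} [AddCommGroup G] {ι : G →ₗ[ℤ] W}

theorem twist_mapDomain (f h : AddMonoidAlgebra K G) :
    twist B η (AddMonoidAlgebra.mapDomainRingHom K ι f)
        (AddMonoidAlgebra.mapDomainRingHom K ι h) =
      AddMonoidAlgebra.mapDomainRingHom K ι (twist (B.compl₁₂ ι ι) η f h) := by
  let r : AddMonoidAlgebra K G →ₗ[K] AddMonoidAlgebra K W :=
    (AddMonoidAlgebra.mapDomainAlgHom K K ι).toLinearMap
  have bilinear : (twist B η).compl₁₂ r r = (twist (B.compl₁₂ ι ι) η).compr₂ r :=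
    (AddMonoidAlgebra.basis G K).ext fun m => (AddMonoidAlgebra.basis G K).ext fun k => by
      simp [r, twist_single_single]
  exact LinearMap.congr_fun₂ bilinear f h

theorem IsBorelPoint.of_twist_map {T : Type*} [Ring T] [Algebra K T] {n : ℕ} {q : K}
    {C : AddMonoidAlgebra K G →ₗ[K] T} (hC : IsWeylMap (B.compl₁₂ ι ι) η C)
    (hι : Function.Injective ι) {M : Matrix (Fin n) (Fin n) (AddMonoidAlgebra K G)}
    (hM : IsBorelPoint q ((M.map (AddMonoidAlgebra.mapDomainRingHom K ι)).map (twist B η))) :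
    IsBorelPoint q (M.map C) := by
  let embed : AddMonoidAlgebra K G →ₗ[K] AddMonoidAlgebra K W :=
    (AddMonoidAlgebra.mapDomainAlgHom K K ι).toLinearMap
  obtain ⟨retract, hretract⟩ := embed.exists_leftInverse_of_injective
    (LinearMap.ker_eq_bot.2 (AddMonoidAlgebra.mapDomain_injective hι))
  refine hM.of_linearMap (C ∘ₗ retract ∘ₗ LinearMap.applyₗ 1) fun l => ?_
  have prod_apply_one : ((l.map fun p => twist B η (embed (M p.1 p.2))).prod : Module.End K _) 1 =
      embed ((l.map fun p => twist (B.compl₁₂ ι ι) η (M p.1 p.2)).prod 1) := by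
    induction l with
    | nil => simp [embed]
    | cons p l ih =>
      simp only [List.map_cons, List.prod_cons, Module.End.mul_apply, ih]
      exact twist_mapDomain _ _
  have map_prod_apply_one : C ((l.map fun p => twist (B.compl₁₂ ι ι) η (M p.1 p.2)).prod 1) =
      (l.map fun p => C (M p.1 p.2)).prod := by
    clear prod_apply_one
    induction l with
    | nil => exact hC.map_one
    | cons p l ih =>
      simp only [List.map_cons, List.prod_cons, Module.End.mul_apply, hC.map_twist, ih]
  exact (congrArg (C ∘ₗ retract) prod_apply_one).trans
    ((congrArg C (LinearMap.congr_fun hretract _)).trans map_prod_apply_one)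

end Twist

section Pullback

variable {K W G T : Type*} [Field K] [AddCommGroup W] [AddCommGroup G] [Ring T] [Algebra K T]
  {B : W →ₗ[ℤ] W →ₗ[ℤ] ℤ} {η : K} {C : AddMonoidAlgebra K W →ₗ[K] T}

theorem IsWeylMap.comp_mapDomain (hC : IsWeylMap B η C) (κ : G →ₗ[ℤ] W) :
    IsWeylMap (B.compl₁₂ κ κ) η (C ∘ₗ (AddMonoidAlgebra.mapDomainAlgHom K K κ).toLinearMap) where
  map_one := by simp [hC.map_one]
  single_mul_single m m' := by simp [hC.single_mul_single]

theorem IsWeylMap.neg (hC : IsWeylMap B η C) : IsWeylMap (-B) η⁻¹ C where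
  map_one := hC.map_one
  single_mul_single m m' := by
    rw [hC.single_mul_single, LinearMap.neg_apply, LinearMap.neg_apply, inv_zpow', neg_neg]

end Pullback

/-! ### The classical left and right matrices -/

theorem list_reverse_Ico_one (n : ℕ) :
    (List.Ico 1 n).reverse = (List.Ico 1 n).map fun b => n - b := by
  apply List.ext_getElem
  · simp
  · intro i h₁ h₂
    simp only [List.length_reverse, List.Ico.length] at h₁
    simp only [List.Ico, List.getElem_reverse, List.getElem_map, List.getElem_range',
      List.length_range']
    omega

section Classical

variable {A A' : Type} [CommRing A] [CommRing A'] {n : ℕ}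

/-- The classical counterpart `M^edge(Z) M^left(X) M^edge(Z')` of the quantum left matrix. -/
def leftProduct (n : ℕ) (x : ℕ → ℕ → ℕ → Aˣ) : Matrix (Fin n) (Fin n) A :=
  edgeMatrix n (fun j => x j 0 (n - j)) * leftMatrix n x * edgeMatrix n (fun j => x j (n - j) 0)

/-- The classical counterpart `M^edge(Z) M^right(X) M^edge(Z'')` of the quantum right matrix. -/
def rightProduct (n : ℕ) (x : ℕ → ℕ → ℕ → Aˣ) : Matrix (Fin n) (Fin n) A :=
  edgeMatrix n (fun j => x j 0 (n - j)) * rightMatrix n x * edgeMatrix n (fun j => x 0 j (n - j))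

theorem edgeShear_map (f : A →+* A') (k : ℕ) (z : Aˣ) :
    (edgeShear n k z).map f = edgeShear n k (Units.map (f : A →* A') z) := by
  ext i j
  simp only [edgeShear, Matrix.map_apply, Matrix.smul_apply, Matrix.diagonal_apply, smul_eq_mul,
    map_mul, ← map_zpow, Units.coe_map, MonoidHom.coe_coe, apply_ite f, map_pow, map_one, map_zero]

theorem leftShear_map (f : A →+* A') (k : ℕ) (z : Aˣ) :
    (leftShear n k z).map f = leftShear n k (Units.map (f : A →* A') z) := by
  ext i j
  simp only [leftShear, Matrix.map_apply, Matrix.smul_apply, Matrix.of_apply, smul_eq_mul, map_mul,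
    ← map_zpow, Units.coe_map, MonoidHom.coe_coe, apply_ite f, map_pow, map_one, map_zero]

theorem matrix_map_list_prod {ι : Type*} (f : A →+* A') (M : ι → Matrix (Fin n) (Fin n) A)
    (l : List ι) : ((l.map M).prod).map f = (l.map fun i => (M i).map f).prod := by
  rw [← RingHom.mapMatrix_apply, map_list_prod, List.map_map]
  rfl

theorem edgeMatrix_map (f : A →+* A') {z : ℕ → Aˣ} {z' : ℕ → A'ˣ}
    (h : ∀ j, 1 ≤ j → j < n → Units.map (f : A →* A') (z j) = z' j) :
    (edgeMatrix n z).map f = edgeMatrix n z' := by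
  rw [edgeMatrix, matrix_map_list_prod, edgeMatrix]
  congr 1
  refine List.map_congr_left fun j hj => ?_
  obtain ⟨hj₁, hjn⟩ := List.Ico.mem.1 hj
  rw [edgeShear_map, h j hj₁ hjn]

theorem leftMatrix_map (f : A →+* A') {x : ℕ → ℕ → ℕ → Aˣ} {x' : ℕ → ℕ → ℕ → A'ˣ}
    (h : ∀ a b c, a + b + c = n → 1 ≤ a → a < n → Units.map (f : A →* A') (x a b c) = x' a b c) :
    (leftMatrix n x).map f = leftMatrix n x' := by
  rw [leftMatrix, matrix_map_list_prod, leftMatrix]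
  congr 1
  refine List.map_congr_left fun k hk => ?_
  rw [List.mem_reverse, List.Ico.mem] at hk
  rw [Matrix.map_mul, leftShear_map, matrix_map_list_prod, map_one]
  congr 2
  refine List.map_congr_left fun l hl => ?_
  rw [List.Ico.mem] at hl
  rw [leftShear_map, h _ _ _ (by omega) (by omega) (by omega)]

theorem leftProduct_map (f : A →+* A') {x : ℕ → ℕ → ℕ → Aˣ} {x' : ℕ → ℕ → ℕ → A'ˣ}
    (h : ∀ a b c, a + b + c = n → 1 ≤ a → a < n → Units.map (f : A →* A') (x a b c) = x' a b c) :
    (leftProduct n x).map f = leftProduct n x' := by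
  rw [leftProduct, Matrix.map_mul, Matrix.map_mul, leftMatrix_map f h,
    edgeMatrix_map f fun j hj hjn => h j 0 (n - j) (by omega) hj hjn,
    edgeMatrix_map f fun j hj hjn => h j (n - j) 0 (by omega) hj hjn, leftProduct]

theorem submatrix_rev_mul (M N : Matrix (Fin n) (Fin n) A) :
    (M * N).submatrix Fin.rev Fin.rev =
      M.submatrix Fin.rev Fin.rev * N.submatrix Fin.rev Fin.rev :=
  (Matrix.submatrix_mul_equiv M N Fin.rev Fin.revPerm Fin.rev).symm

theorem submatrix_rev_list_prod {ι : Type*} (M : ι → Matrix (Fin n) (Fin n) A) (l : List ι) :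
    ((l.map M).prod).submatrix Fin.rev Fin.rev =
      (l.map fun i => (M i).submatrix Fin.rev Fin.rev).prod := by
  induction l with
  | nil => exact Matrix.submatrix_one_equiv Fin.revPerm
  | cons a l ih =>
    rw [List.map_cons, List.prod_cons, submatrix_rev_mul, ih, List.map_cons, List.prod_cons]

theorem rightShear_eq_submatrix_rev (k : ℕ) (x : Aˣ) :
    rightShear n k x = (leftShear n k x⁻¹).submatrix Fin.rev Fin.rev := by
  ext i j
  have diag_iff : n < (i : ℕ) + k ↔ n - (i + 1) + 1 < k := by omega
  have offdiag_iff : (i : ℕ) + k = n ∧ (j : ℕ) + 1 = i ↔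
      n - ((i : ℕ) + 1) + 1 = k ∧ n - ((j : ℕ) + 1) = k := by omega
  simp only [rightShear, leftShear, Matrix.submatrix_apply, Matrix.smul_apply, Matrix.of_apply,
    Fin.rev_inj, Fin.val_rev, inv_zpow', neg_neg, diag_iff, offdiag_iff]

theorem edgeShear_eq_submatrix_rev {k : ℕ} (hk : k ≤ n) (z : Aˣ) :
    edgeShear n (n - k) z = (edgeShear n k z⁻¹).submatrix Fin.rev Fin.rev := by
  ext i j
  simp only [edgeShear, Matrix.submatrix_apply, Matrix.smul_apply, Matrix.diagonal_apply,
    Fin.rev_inj, smul_eq_mul, mul_ite, mul_zero]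
  refine if_congr Iff.rfl ?_ rfl
  have rev_lt : (Fin.rev i : ℕ) < k ↔ ¬(i : ℕ) < n - k := by
    rw [Fin.val_rev]
    omega
  simp only [rev_lt, ite_not, ← Units.val_pow_eq_pow_val, ← Units.val_mul, mul_one]
  split_ifs
  all_goals
    congr 1
    rw [Nat.cast_sub hk]
    group

theorem edgeMatrix_eq_submatrix_rev {z z' : ℕ → Aˣ}
    (h : ∀ j, 1 ≤ j → j < n → z' j = (z (n - j))⁻¹) :
    edgeMatrix n z = (edgeMatrix n z').submatrix Fin.rev Fin.rev := by
  have prod_reverse : edgeMatrix n z =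
      ((List.Ico 1 n).reverse.map fun j => edgeShear n j (z j)).prod :=
    ((List.reverse_perm _).symm.map _).prod_eq' <| List.pairwise_map.2 <|
      List.pairwise_of_forall fun i j => ((Matrix.commute_diagonal _ _).smul_left _).smul_right _
  rw [prod_reverse, list_reverse_Ico_one, List.map_map, edgeMatrix, submatrix_rev_list_prod]
  congr 1
  refine List.map_congr_left fun j hj => ?_
  obtain ⟨hj₁, hjn⟩ := List.Ico.mem.1 hj
  rw [Function.comp_apply, edgeShear_eq_submatrix_rev hjn.le, h j hj₁ hjn]

theorem rightMatrix_eq_submatrix_rev (x : ℕ → ℕ → ℕ → Aˣ) :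
    rightMatrix n x = (leftMatrix n fun a b c => (x c b a)⁻¹).submatrix Fin.rev Fin.rev := by
  simp only [rightMatrix, leftMatrix, submatrix_rev_list_prod, submatrix_rev_mul,
    rightShear_eq_submatrix_rev, inv_one]

theorem rightProduct_eq_submatrix_rev (x : ℕ → ℕ → ℕ → Aˣ) :
    rightProduct n x = (leftProduct n fun a b c => (x c b a)⁻¹).submatrix Fin.rev Fin.rev := by
  have sub_sub (j : ℕ) (hj : j < n) : n - (n - j) = j := by omega
  rw [rightProduct, leftProduct, submatrix_rev_mul, submatrix_rev_mul, rightMatrix_eq_submatrix_rev]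
  refine congrArg₂ _ (congrArg₂ _ (edgeMatrix_eq_submatrix_rev fun j _ hj => ?_) rfl)
    (edgeMatrix_eq_submatrix_rev fun j _ hj => ?_)
  all_goals rw [sub_sub j hj]

end Classical

/-! ### Monomial diagonal matrices and elementary steps -/

theorem prod_Ico_mul_comm_shift {M : Type*} [Monoid M] (d s : ℕ → M) {m k : ℕ} (h : m ≤ k) :
    ((List.Ico m k).map fun b => d b * s b).prod * d k =
      d m * ((List.Ico m k).map fun b => s b * d (b + 1)).prod := by
  induction k, h using Nat.le_induction with
  | base => simp
  | succ k h ih =>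
    simp only [List.Ico.succ_top h, List.map_append, List.prod_append, List.map_singleton,
      List.prod_singleton, ← mul_assoc] at ih ⊢
    rw [ih]

theorem sum_Ico_eq_sum_range {M : Type*} [AddCommMonoid M] {f : ℕ → M} {k n : ℕ} (hk : k ≤ n)
    (h₀ : f 0 = 0) (hf : ∀ a, k < a → a ≤ n → f a = 0) :
    ((List.Ico 1 (k + 1)).map f).sum = ∑ a ∈ Finset.range (n + 1), f a := by
  refine Finset.sum_subset (s₁ := Finset.Ico 1 (k + 1)) (fun a ha => ?_) fun a ha ha' => ?_
  · simp only [Finset.mem_Ico, Finset.mem_range] at ha ⊢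
    omega
  · simp only [Finset.mem_Ico, Finset.mem_range] at ha ha'
    obtain rfl | hka : a = 0 ∨ k < a := by omega
    exacts [h₀, hf a hka (by omega)]

section Monomials

variable {K W : Type} [CommRing K] [AddCommGroup W] {n : ℕ}

/-- The monomial of exponent `w`, as a unit of the group algebra. -/
def monomialUnit (K : Type) [CommRing K] (w : W) : (AddMonoidAlgebra K W)ˣ where
  val := .single w 1
  inv := .single (-w) 1
  val_inv := by rw [AddMonoidAlgebra.single_mul_single, add_neg_cancel, one_mul]; rfl
  inv_val := by rw [AddMonoidAlgebra.single_mul_single, neg_add_cancel, one_mul]; rfl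

theorem val_monomialUnit (w : W) :
    (monomialUnit K w : AddMonoidAlgebra K W) = .single w 1 := rfl

theorem monomialUnit_inv (w : W) : (monomialUnit K w)⁻¹ = monomialUnit K (-w) :=
  Units.ext rfl

theorem monomialUnit_pow (w : W) (r : ℕ) : monomialUnit K w ^ r = monomialUnit K (r • w) := by
  ext1
  rw [Units.val_pow_eq_pow_val, val_monomialUnit, val_monomialUnit, AddMonoidAlgebra.single_pow,
    one_pow]

theorem monomialUnit_zpow (w : W) (r : ℤ) : monomialUnit K w ^ r = monomialUnit K (r • w) := by
  obtain ⟨r, rfl | rfl⟩ := r.eq_nat_or_neg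
  · rw [zpow_natCast, monomialUnit_pow, natCast_zsmul]
  · rw [zpow_neg, zpow_natCast, monomialUnit_pow, monomialUnit_inv, neg_smul, natCast_zsmul]

/-- The diagonal matrix whose entries are the monomials with exponents `t`. -/
def diagMono (K : Type) [CommRing K] (t : Fin n → W) :
    Matrix (Fin n) (Fin n) (AddMonoidAlgebra K W) :=
  Matrix.diagonal fun i => .single (t i) 1

theorem diagMono_add (t t' : Fin n → W) : diagMono K (t + t') = diagMono K t * diagMono K t' := by
  simp only [diagMono, Matrix.diagonal_mul_diagonal, AddMonoidAlgebra.single_mul_single, one_mul,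
    Pi.add_apply]

theorem diagMono_zero : diagMono K (0 : Fin n → W) = 1 := Matrix.diagonal_one

theorem commute_diagMono (t t' : Fin n → W) : Commute (diagMono K t) (diagMono K t') :=
  Matrix.commute_diagonal _ _

theorem prod_map_diagMono {ι : Type*} (t : ι → Fin n → W) (l : List ι) :
    (l.map fun a => diagMono K (t a)).prod = diagMono K (l.map t).sum := by
  induction l with
  | nil => exact diagMono_zero.symm
  | cons a l ih => rw [List.map_cons, List.prod_cons, ih, List.map_cons, List.sum_cons,
      diagMono_add]

/-- The `i`-th diagonal entry of `S_k^edge(Z)` is `Z^{1/n}` raised to this power. -/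
def edgeWeight (n k : ℕ) (i : Fin n) : ℤ := (if (i : ℕ) < k then (n : ℤ) else 0) - k

theorem edgeWeight_zero (i : Fin n) : edgeWeight n 0 i = 0 := by simp [edgeWeight]

theorem edgeWeight_self (i : Fin n) : edgeWeight n n i = 0 := by simp [edgeWeight]

theorem edgeWeight_succ (k : ℕ) (i : Fin n) :
    edgeWeight n (k + 1) i = edgeWeight n k i + n * (if (i : ℕ) = k then 1 else 0) - 1 := by
  unfold edgeWeight
  split_ifs <;> omega

theorem edgeWeight_eq_of_ne {j k : ℕ} (hjk : j ≠ k) {i i' : Fin n} (hi : (i : ℕ) + 1 = k)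
    (hi' : (i' : ℕ) = k) : edgeWeight n j i = edgeWeight n j i' := by
  have : (i : ℕ) < j ↔ (i' : ℕ) < j := by omega
  simp only [edgeWeight, this]

theorem sum_edgeWeight {k : ℕ} (hk : k ≤ n) : ∑ i : Fin n, edgeWeight n k i = 0 := by
  simp only [edgeWeight, Finset.sum_sub_distrib, Finset.sum_ite, Finset.sum_const,
    Fin.card_filter_val_lt, min_eq_right hk]
  simp [mul_comm]

/-- The exponents of the diagonal matrix `S_k^edge(Z)` when `Z^{1/n}` is the monomial `w`. -/
def edgeExp (n k : ℕ) (w : W) : Fin n → W := fun i => edgeWeight n k i • w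

theorem edgeExp_zero (w : W) : edgeExp n 0 w = 0 :=
  funext fun i => by rw [edgeExp, edgeWeight_zero, zero_smul, Pi.zero_apply]

theorem edgeExp_self (w : W) : edgeExp n n w = 0 :=
  funext fun i => by rw [edgeExp, edgeWeight_self, zero_smul, Pi.zero_apply]

theorem edgeExp_apply_zero (k : ℕ) : edgeExp n k (0 : W) = 0 :=
  funext fun _ => smul_zero _

theorem edgeExp_add (k : ℕ) (w w' : W) :
    edgeExp n k (w + w') = edgeExp n k w + edgeExp n k w' :=
  funext fun _ => smul_add _ _ _

theorem edgeExp_neg (k : ℕ) (w : W) : edgeExp n k (-w) = -edgeExp n k w :=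
  funext fun _ => smul_neg _ _

theorem edgeShear_monomialUnit (k : ℕ) (w : W) :
    edgeShear n k (monomialUnit K w) = diagMono K (edgeExp n k w) := by
  rw [edgeShear, ← Matrix.diagonal_smul, diagMono]
  congr 1
  funext i
  rw [Pi.smul_apply, smul_eq_mul, ← val_monomialUnit, edgeExp, edgeWeight,
    ← monomialUnit_zpow, sub_eq_neg_add, zpow_add, Units.val_mul]
  split_ifs
  · rw [zpow_natCast, Units.val_pow_eq_pow_val]
  · rw [zpow_zero, Units.val_one]

/-- The matrix `1 + E_{k,k+1}`. -/
abbrev step (A : Type) [CommRing A] (n k : ℕ) : Matrix (Fin n) (Fin n) A := leftShear n k 1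

theorem step_apply {A : Type} [CommRing A] (k : ℕ) (i j : Fin n) :
    step A n k i j = if i = j then 1 else if (i : ℕ) + 1 = k ∧ (j : ℕ) = k then 1 else 0 := by
  simp [leftShear]

theorem leftShear_monomialUnit (k : ℕ) (w : W) :
    leftShear n (k + 1) (monomialUnit K w) = diagMono K (edgeExp n k w) * step _ n (k + 1) := by
  have edge_eq := congrFun₂ (edgeShear_monomialUnit (K := K) (n := n) k w)
  ext1 i j
  rw [diagMono, Matrix.diagonal_mul, step_apply]
  have edge_diag := edge_eq i i
  simp only [edgeShear, diagMono, Matrix.smul_apply, Matrix.diagonal_apply_eq, smul_eq_mul]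
    at edge_diag
  simp only [leftShear, Matrix.smul_apply, Matrix.of_apply, smul_eq_mul, ← edge_diag,
    Nat.cast_add_one, add_sub_cancel_right, add_lt_add_iff_right]
  split_ifs <;> first | omega | simp

theorem commute_diagMono_step {k : ℕ} {t : Fin n → W}
    (ht : ∀ i j : Fin n, (i : ℕ) + 1 = k → (j : ℕ) = k → t i = t j) :
    Commute (diagMono K t) (step _ n k) := by
  ext1 i j
  rw [diagMono, Matrix.diagonal_mul, Matrix.mul_diagonal, step_apply]
  split_ifs with hij hk
  · rw [hij, mul_comm]
  · rw [ht i j hk.1 hk.2, mul_comm]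
  · rw [mul_zero, zero_mul]

theorem commute_edgeExp_step {j k : ℕ} (hjk : j ≠ k) (w : W) :
    Commute (diagMono K (edgeExp n j w)) (step _ n k) :=
  commute_diagMono_step fun i i' hi hi' => by
    rw [edgeExp, edgeExp, edgeWeight_eq_of_ne hjk hi hi']

theorem commute_edgeExp_leftShear {j k : ℕ} (hk : 1 ≤ k) (hjk : j ≠ k) (w x : W) :
    Commute (diagMono K (edgeExp n j w)) (leftShear n k (monomialUnit K x)) := by
  obtain ⟨k, rfl⟩ := Nat.exists_eq_add_of_le' hk
  rw [leftShear_monomialUnit]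
  exact (commute_diagMono _ _).mul_right (commute_edgeExp_step hjk w)

/-- The exponents of a product of edge-shearing matrices `S_a^edge(Z_a)`. -/
def edgeSum (n : ℕ) (x : ℕ → W) : Fin n → W := ∑ a ∈ Finset.range (n + 1), edgeExp n a (x a)

theorem edgeSum_zero : edgeSum n (fun _ => (0 : W)) = 0 :=
  Finset.sum_eq_zero fun _ _ => edgeExp_apply_zero _

theorem edgeSum_add (x x' : ℕ → W) :
    edgeSum n (fun a => x a + x' a) = edgeSum n x + edgeSum n x' := by
  simp only [edgeSum, edgeExp_add, Finset.sum_add_distrib]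

theorem edgeSum_sub (x x' : ℕ → W) :
    edgeSum n (fun a => x a - x' a) = edgeSum n x - edgeSum n x' := by
  simp only [sub_eq_add_neg, edgeSum, edgeExp_add, edgeExp_neg, Finset.sum_add_distrib,
    Finset.sum_neg_distrib]

theorem sum_Ico_edgeExp {k : ℕ} (hk : k ≤ n) {x : ℕ → W}
    (hx : ∀ a, k < a → a < n → x a = 0) :
    ((List.Ico 1 (k + 1)).map fun a => edgeExp n a (x a)).sum = edgeSum n x := by
  refine sum_Ico_eq_sum_range hk (edgeExp_zero _) fun a hka han => ?_
  obtain rfl | han := han.eq_or_lt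
  · exact edgeExp_self _
  · rw [hx a hka han, edgeExp_apply_zero]

theorem edgeMatrix_monomialUnit (x : ℕ → W) :
    edgeMatrix n (fun a => monomialUnit K (x a)) = diagMono K (edgeSum n x) := by
  simp only [edgeMatrix, edgeShear_monomialUnit, prod_map_diagMono]
  obtain _ | n := n
  · exact Subsingleton.elim _ _
  · rw [← sum_Ico_edgeExp n.le_succ (x := x) fun a _ _ => by omega]

end Monomials

/-! ### Factorization of the left matrix -/

section Factorization

variable {K W : Type} [CommRing K] [AddCommGroup W] {n : ℕ}

/-- The product of the steps `1, …, k`. -/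
def stepProd (A : Type) [CommRing A] (n k : ℕ) : Matrix (Fin n) (Fin n) A :=
  ((List.Ico 1 (k + 1)).map (step A n)).prod

/-- The part `S₁ S₂(X₁) ⋯ S_k(X_{k-1})` of the left matrix, with monomial coordinates. -/
def leftBlock (K : Type) [CommRing K] (n k : ℕ) (x : ℕ → W) :
    Matrix (Fin n) (Fin n) (AddMonoidAlgebra K W) :=
  leftShear n 1 1 *
    ((List.Ico 2 (k + 1)).map fun l => leftShear n l (monomialUnit K (x (l - 1)))).prod

theorem leftBlock_mul_edge {k : ℕ} (hk : 1 ≤ k) (hkn : k ≤ n) {x : ℕ → W}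
    (hx : ∀ a, k < a → a < n → x a = 0) :
    leftBlock K n k x * diagMono K (edgeExp n k (x k)) =
      stepProd _ n k * diagMono K (edgeSum n x) := by
  have shear_eq : (List.Ico 2 (k + 1)).map (fun l => leftShear n l (monomialUnit K (x (l - 1)))) =
      (List.Ico 2 (k + 1)).map fun l =>
        diagMono K (edgeExp n (l - 1) (x (l - 1))) * step _ n l :=
    List.map_congr_left fun l hl => by
      obtain ⟨l, rfl⟩ := Nat.exists_eq_add_of_le' (List.Ico.mem.1 hl).1
      exact leftShear_monomialUnit (l + 1) _
  have shift := prod_Ico_mul_comm_shift (fun l => diagMono K (edgeExp n (l - 1) (x (l - 1))))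
    (step _ n) (show 2 ≤ k + 1 by omega)
  simp only [Nat.add_sub_cancel] at shift
  rw [leftBlock, shear_eq, mul_assoc, shift, stepProd, ← sum_Ico_edgeExp hkn hx,
    ← prod_map_diagMono, ← prod_map_mul_of_pairwise_commute,
    List.Ico.eq_cons (show 1 < k + 1 by omega), List.map_cons, List.prod_cons, mul_assoc]
  exact (List.Ico.pairwise_lt 1 (k + 1)).imp fun h => commute_edgeExp_step h.ne _

theorem leftMatrix_mul_edgeMatrix {x : ℕ → ℕ → W} (hx : ∀ a b, n < a + b → x a b = 0) :
    leftMatrix n (fun a b _ => monomialUnit K (x a b)) *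
        edgeMatrix n (fun a => monomialUnit K (x a (n - a))) =
      ((List.Ico 1 n).map fun b =>
        stepProd _ n (n - b) * diagMono K (edgeSum n fun a => x a b)).prod := by
  have left_eq : leftMatrix n (fun a b _ => monomialUnit K (x a b)) =
      ((List.Ico 1 n).map fun b => leftBlock K n (n - b) fun a => x a b).prod := by
    rw [leftMatrix, list_reverse_Ico_one, List.map_map]
    refine congrArg List.prod (List.map_congr_left fun b hb => ?_)
    rw [Function.comp_apply, Nat.sub_sub_self (List.Ico.mem.1 hb).2.le, leftBlock]
  have edge_eq : edgeMatrix n (fun a => monomialUnit K (x a (n - a))) =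
      ((List.Ico 1 n).map fun b => diagMono K (edgeExp n (n - b) (x (n - b) b))).prod := by
    simp only [edgeMatrix, edgeShear_monomialUnit, prod_map_diagMono]
    rw [← List.sum_reverse, ← List.map_reverse, list_reverse_Ico_one, List.map_map]
    refine congrArg (fun l => diagMono K (List.sum l)) (List.map_congr_left fun b hb => ?_)
    rw [Function.comp_apply, Nat.sub_sub_self (List.Ico.mem.1 hb).2.le]
  rw [left_eq, edge_eq, ← prod_map_mul_of_pairwise_commute]
  · refine congrArg List.prod (List.map_congr_left fun b hb => ?_)
    have hb := List.Ico.mem.1 hb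
    exact leftBlock_mul_edge (by omega) (by omega) fun a ha _ => hx a b (by omega)
  · refine (List.Ico.pairwise_lt 1 n).imp_of_mem fun {b b'} _ hb' hlt => ?_
    have hb' := List.Ico.mem.1 hb'
    refine .mul_right (commute_edgeExp_step (by omega) _) (Commute.list_prod_right _ _ ?_)
    refine List.forall_mem_map.2 fun l hl => commute_edgeExp_leftShear ?_ ?_ _ _ <;>
      have := List.Ico.mem.1 hl <;> omega

/-- The exponents of the diagonal matrix to the left of the step in an elementary factor. -/
def inExp (n a : ℕ) (u y : W) : Fin n → W := edgeExp n a (y + (2 : ℤ) • u) - edgeExp n (a + 1) u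

/-- The exponents of the diagonal matrix to the right of the step in an elementary factor. -/
def outExp (n a : ℕ) (u y : W) : Fin n → W := -edgeExp n a y - edgeExp n (a - 1) u

/-- The elementary factor of type `a`: a bidiagonal matrix in the monomials `u` and `y`, see
`elementary_eq_bidiagonal`. -/
def elementary (K : Type) [CommRing K] (n a : ℕ) (u y : W) :
    Matrix (Fin n) (Fin n) (AddMonoidAlgebra K W) :=
  diagMono K (inExp n a u y) * step _ n a * diagMono K (outExp n a u y)

theorem elementary_eq_bidiagonal {a : ℕ} (ha : 1 ≤ a) (u y : W) :
    elementary K n a u y = bidiagonal a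
      (fun i => .single (((n : ℤ) *
        ((if (i : ℕ) + 1 = a then 1 else 0) - (if (i : ℕ) = a then 1 else 0))) • u) 1)
      (.single ((n : ℤ) • (y + u)) 1) := by
  obtain ⟨a, rfl⟩ := Nat.exists_eq_add_of_le' ha
  ext1 i j
  rw [elementary, diagMono, diagMono, Matrix.mul_diagonal, Matrix.diagonal_mul, step_apply]
  simp only [bidiagonal, Matrix.of_apply, inExp, outExp, Pi.sub_apply, Pi.neg_apply, edgeExp,
    edgeWeight_succ, Nat.add_sub_cancel, add_left_inj]
  obtain rfl | hij := eq_or_ne i j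
  · rw [if_pos rfl, if_pos rfl, mul_one, AddMonoidAlgebra.single_mul_single, one_mul]
    congr 1
    module
  · rw [if_neg hij, if_neg hij]
    by_cases hoff : (i : ℕ) = a ∧ (j : ℕ) = a + 1
    · rw [if_pos hoff, if_pos hoff, mul_one, AddMonoidAlgebra.single_mul_single, one_mul,
        edgeWeight_eq_of_ne a.lt_succ_self.ne (congrArg (· + 1) hoff.1) hoff.2, if_pos hoff.1,
        if_neg (by omega), if_neg (by omega)]
      congr 1
      module
    · rw [if_neg hoff, if_neg hoff, mul_zero, zero_mul]

theorem prod_elementary (u y : ℕ → W) (k : ℕ) :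
    ((List.Ico 1 (k + 1)).map fun a => elementary K n a (u a) (y a)).prod =
      diagMono K (((List.Ico 1 (k + 1)).map fun a => inExp n a (u a) (y a)).sum) *
        stepProd _ n k *
        diagMono K (((List.Ico 1 (k + 1)).map fun a => outExp n a (u a) (y a)).sum) := by
  have split_in := prod_map_mul_of_pairwise_commute (fun a => diagMono K (inExp n a (u a) (y a)))
    (step _ n) (List.Ico 1 (k + 1)) <| (List.Ico.pairwise_lt 1 (k + 1)).imp fun {a b} h =>
      (commute_diagMono_step fun i i' hi hi' => by
        simp only [inExp, edgeExp, Pi.sub_apply]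
        rw [edgeWeight_eq_of_ne (by omega) hi hi', edgeWeight_eq_of_ne (by omega) hi hi']).symm
  have split_out := prod_map_mul_of_pairwise_commute
    (fun a => diagMono K (inExp n a (u a) (y a)) * step _ n a)
    (fun a => diagMono K (outExp n a (u a) (y a))) (List.Ico 1 (k + 1)) <|
      (List.Ico.pairwise_lt 1 (k + 1)).imp fun {a b} h =>
        (commute_diagMono _ _).mul_right (commute_diagMono_step fun i i' hi hi' => by
          simp only [outExp, edgeExp, Pi.sub_apply, Pi.neg_apply]
          rw [edgeWeight_eq_of_ne (by omega) hi hi', edgeWeight_eq_of_ne (by omega) hi hi'])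
  simp only [elementary]
  rw [split_out, split_in, prod_map_diagMono, prod_map_diagMono, stepProd]

theorem sum_inExp {k : ℕ} (hk : k < n) {u y : ℕ → W} (hu : ∀ a, a = 0 ∨ k < a → u a = 0)
    (hy : ∀ a, k < a → y a = 0) :
    ((List.Ico 1 (k + 1)).map fun a => inExp n a (u a) (y a)).sum =
      edgeSum n fun a => y a + (2 : ℤ) • u a - u (a - 1) := by
  have shift : ∑ a ∈ Finset.range (n + 1), edgeExp n (a + 1) (u a) =
      edgeSum n fun a => u (a - 1) := by
    rw [edgeSum, Finset.sum_range_succ, hu n (.inr hk), edgeExp_apply_zero,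
      Finset.sum_range_succ' fun a => edgeExp n a (u (a - 1)), edgeExp_zero]
    rfl
  rw [sum_Ico_eq_sum_range hk.le]
  · simp only [inExp, Finset.sum_sub_distrib, shift, edgeSum_sub]
    rfl
  · rw [inExp, edgeExp_zero, hu 0 (.inl rfl), edgeExp_apply_zero, sub_zero]
  · intro a ha _
    simp only [inExp, hu a (.inr ha), hy a ha, smul_zero, add_zero, edgeExp_apply_zero, sub_zero]

theorem sum_outExp {k : ℕ} (hk : k ≤ n) {u y : ℕ → W} (hu : ∀ a, k < a → u a = 0)
    (hy : ∀ a, k < a → y a = 0) :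
    ((List.Ico 1 (k + 1)).map fun a => outExp n a (u a) (y a)).sum =
      edgeSum n fun a => -y a - u (a + 1) := by
  have shift : ∑ a ∈ Finset.range (n + 1), edgeExp n (a - 1) (u a) =
      edgeSum n fun a => u (a + 1) := by
    rw [edgeSum, Finset.sum_range_succ', Finset.sum_range_succ, edgeExp_self, edgeExp_zero]
    rfl
  rw [sum_Ico_eq_sum_range hk]
  · simp only [outExp, Finset.sum_sub_distrib, shift, ← edgeExp_neg, edgeSum_sub]
    rfl
  · rw [outExp, edgeExp_zero, edgeExp_zero, neg_zero, sub_zero]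
  · intro a ha _
    simp only [outExp, hu a ha, hy a ha, edgeExp_apply_zero, neg_zero, sub_zero]

/-- The exponent of the coordinate at `(a, b)` in terms of those of the parameters `u`, `y` of the
elementary factors and of diagonal parameters `g`. -/
def vertexExp (u y g : ℕ → ℕ → W) (a b : ℕ) : W :=
  -y a b - u (a + 1) b + g a b + (y a (b + 1) + (2 : ℤ) • u a (b + 1)) - u (a - 1) (b + 1)

variable {u y g : ℕ → ℕ → W}

theorem edgeSum_vertexExp (b : ℕ) :
    edgeSum n (fun a => vertexExp u y g a b) =
      edgeSum n (fun a => -y a b - u (a + 1) b) + edgeSum n (fun a => g a b) +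
        edgeSum n fun a => y a (b + 1) + (2 : ℤ) • u a (b + 1) - u (a - 1) (b + 1) := by
  simp only [← edgeSum_add, vertexExp, ← add_sub_assoc]

theorem prod_elementary_block (hu : ∀ a b, a = 0 ∨ b = 0 ∨ n < a + b → u a b = 0)
    (hy : ∀ a b, a = 0 ∨ b = 0 ∨ n < a + b → y a b = 0) {b : ℕ} (hb : b ∈ List.Ico 1 n) :
    ((List.Ico 1 (n - b + 1)).map fun a => elementary K n a (u a b) (y a b)).prod =
      diagMono K (edgeSum n fun a => y a b + (2 : ℤ) • u a b - u (a - 1) b) *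
        (stepProd _ n (n - b) * diagMono K (edgeSum n fun a => -y a b - u (a + 1) b)) := by
  have hb := List.Ico.mem.1 hb
  rw [prod_elementary, sum_inExp (u := fun a => u a b) (y := fun a => y a b) (by omega)
      (fun a _ => hu a b (by omega)) fun a _ => hy a b (by omega),
    sum_outExp (u := fun a => u a b) (y := fun a => y a b) (n.sub_le b)
      (fun a _ => hu a b (by omega)) fun a _ => hy a b (by omega), mul_assoc]

theorem leftProduct_eq_prod_elementary (hu : ∀ a b, a = 0 ∨ b = 0 ∨ n < a + b → u a b = 0)
    (hy : ∀ a b, a = 0 ∨ b = 0 ∨ n < a + b → y a b = 0) (hg : ∀ a b, n < a + b → g a b = 0) :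
    leftProduct n (fun a b _ => monomialUnit K (vertexExp u y g a b)) =
      diagMono K (edgeSum n fun a => g a 0) *
        ((List.Ico 1 n).map fun b =>
          ((List.Ico 1 (n - b + 1)).map fun a => elementary K n a (u a b) (y a b)).prod *
            diagMono K (edgeSum n fun a => g a b)).prod := by
  obtain rfl | hn := Nat.eq_zero_or_pos n
  · exact Subsingleton.elim _ _
  have vertexExp_eq_zero : ∀ a b, n < a + b → vertexExp u y g a b = 0 := fun a b hab => by
    rw [vertexExp, hu (a + 1) b (by omega), hu a (b + 1) (by omega),
      hu (a - 1) (b + 1) (by omega), hy a b (by omega), hy a (b + 1) (by omega), hg a b hab]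
    simp
  let inDiag (b : ℕ) := diagMono K (edgeSum n fun a => y a b + (2 : ℤ) • u a b - u (a - 1) b)
  let outDiag (b : ℕ) := diagMono K (edgeSum n fun a => -y a b - u (a + 1) b)
  let gDiag (b : ℕ) := diagMono K (edgeSum n fun a => g a b)
  have edge_vertex (b : ℕ) : diagMono K (edgeSum n fun a => vertexExp u y g a b) =
      outDiag b * gDiag b * inDiag (b + 1) := by rw [edgeSum_vertexExp, diagMono_add, diagMono_add]
  have outDiag_zero : outDiag 0 = 1 := by
    simp only [outDiag, hu _ 0 (.inr (.inl rfl)), hy _ 0 (.inr (.inl rfl)), neg_zero, sub_zero,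
      edgeSum_zero, diagMono_zero]
  have inDiag_self : inDiag n = 1 := by
    have hu_n (a : ℕ) : u a n = 0 := hu a n (by omega)
    have hy_n (a : ℕ) : y a n = 0 := hy a n (by omega)
    simp only [inDiag, hu_n, hy_n, smul_zero, add_zero, sub_zero, edgeSum_zero, diagMono_zero]
  have block_eq : ∀ b ∈ List.Ico 1 n,
      ((List.Ico 1 (n - b + 1)).map fun a => elementary K n a (u a b) (y a b)).prod * gDiag b =
        inDiag b * (stepProd _ n (n - b) * outDiag b * gDiag b) := fun b hb => by
    rw [prod_elementary_block hu hy hb, mul_assoc]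
  have shift := prod_Ico_mul_comm_shift inDiag (fun b => stepProd _ n (n - b) * outDiag b * gDiag b)
    (show 1 ≤ n from hn)
  rw [inDiag_self, mul_one] at shift
  rw [leftProduct, mul_assoc, leftMatrix_mul_edgeMatrix vertexExp_eq_zero, edgeMatrix_monomialUnit,
    edge_vertex, outDiag_zero, one_mul, mul_assoc, List.map_congr_left block_eq, shift]
  simp only [edge_vertex, mul_assoc, gDiag, zero_add]

end Factorization

/-! ### Canonical parameters of the left matrix -/

theorem exponentForm_isAlt {V : Type} {P : V → V → ℤ} (hP : ∀ v w, P v w = -P w v) :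
    (exponentForm P).IsAlt := fun x => by
  have flip_eq : (exponentForm P).flip = -exponentForm P := by
    ext v w
    simp [exponentForm_single, hP w v]
  have := LinearMap.congr_fun₂ flip_eq x x
  rw [LinearMap.flip_apply, LinearMap.neg_apply, LinearMap.neg_apply] at this
  omega

theorem exponentForm_eq_zero {V : Type} {P : V → V → ℤ} {s t : Set V}
    (hP : ∀ v ∈ s, ∀ w ∈ t, P v w = 0) {x y : V →₀ ℤ} (hx : x ∈ Finsupp.supported ℤ ℤ s)
    (hy : y ∈ Finsupp.supported ℤ ℤ t) : exponentForm P x y = 0 := by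
  rw [exponentForm, Finsupp.linearCombination_apply, Finsupp.sum, LinearMap.sum_apply]
  refine Finset.sum_eq_zero fun v hv => ?_
  rw [LinearMap.smul_apply, Finsupp.linearCombination_apply, Finsupp.sum]
  refine smul_eq_zero_of_right _ (Finset.sum_eq_zero fun w hw => ?_)
  rw [hP v (hx hv) w (hy hw), smul_zero]

/-- The parameters in which the left matrix factors: a canonical pair `u_p`, `y_p` and a central
parameter `g_p` for every position `p = (a, b)`. -/
inductive Param
  | u (p : ℕ × ℕ)
  | y (p : ℕ × ℕ)
  | g (p : ℕ × ℕ)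

namespace Param

/-- The commutation matrix of the parameters. -/
def poisson : Param → Param → ℤ
  | y p, u p' => if p = p' then 1 else 0
  | u p, y p' => if p = p' then -1 else 0
  | _, _ => 0

theorem poisson_antisymm (v w : Param) : poisson v w = -poisson w v := by
  cases v <;> cases w <;> simp only [poisson] <;> grind

/-- The commutation form on the exponents of the parameters. -/
def form : (Param →₀ ℤ) →ₗ[ℤ] (Param →₀ ℤ) →ₗ[ℤ] ℤ := exponentForm poisson

theorem form_isAlt : form.IsAlt := exponentForm_isAlt poisson_antisymm

/-- The parameters other than the `u_p` and `y_p` with `p ∉ Q`. -/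
def atPositions (Q : Set (ℕ × ℕ)) : Set Param
  | u p => p ∈ Q
  | y p => p ∈ Q
  | g _ => True

/-- The exponents involving `u_p` and `y_p` for `p ∈ Q` only. -/
def subgroup (Q : Set (ℕ × ℕ)) : AddSubgroup (Param →₀ ℤ) :=
  (Finsupp.supported ℤ ℤ (atPositions Q)).toAddSubgroup

theorem single_mem_subgroup {Q : Set (ℕ × ℕ)} {v : Param} (hv : v ∈ atPositions Q) (r : ℤ) :
    Finsupp.single v r ∈ subgroup Q := Finsupp.single_mem_supported ℤ r hv

theorem subgroup_mono {Q Q' : Set (ℕ × ℕ)} (h : Q ⊆ Q') : subgroup Q ≤ subgroup Q' := by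
  refine Finsupp.supported_mono (M := ℤ) (R := ℤ) (fun v hv => ?_ : atPositions Q ⊆ atPositions Q')
  cases v
  exacts [h hv, h hv, trivial]

theorem form_eq_zero {Q Q' : Set (ℕ × ℕ)} (h : Disjoint Q Q') :
    ∀ x ∈ subgroup Q, ∀ y ∈ subgroup Q', form x y = 0 := by
  refine fun x hx y hy => exponentForm_eq_zero (fun v hv w hw => ?_) hx hy
  cases v <;> cases w <;> first | rfl | exact if_neg (h.ne_of_mem hv hw)

/-- The exponent of `u_{ab}`, zero outside the range of the factors. -/
def uExp (n a b : ℕ) : Param →₀ ℤ := if 1 ≤ a ∧ 1 ≤ b ∧ a + b ≤ n then .single (u (a, b)) 1 else 0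

/-- The exponent of `y_{ab}`, zero outside the range of the factors. -/
def yExp (n a b : ℕ) : Param →₀ ℤ := if 1 ≤ a ∧ 1 ≤ b ∧ a + b ≤ n then .single (y (a, b)) 1 else 0

/-- The exponent of `g_{ab}`, zero outside the triangle. -/
def gExp (n a b : ℕ) : Param →₀ ℤ := if a + b ≤ n then .single (g (a, b)) 1 else 0

variable {n : ℕ}

theorem form_u_u (a b a' b' : ℕ) : form (uExp n a b) (uExp n a' b') = 0 := by
  rw [form, uExp, uExp]
  split_ifs <;> simp [exponentForm_single, poisson]

theorem form_y_y (a b a' b' : ℕ) : form (yExp n a b) (yExp n a' b') = 0 := by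
  rw [form, yExp, yExp]
  split_ifs <;> simp [exponentForm_single, poisson]

theorem form_y_u_self {a b : ℕ} (h : 1 ≤ a ∧ 1 ≤ b ∧ a + b ≤ n) :
    form (yExp n a b) (uExp n a b) = 1 := by
  rw [form, yExp, uExp, if_pos h, if_pos h, exponentForm_single]
  simp [poisson]

theorem form_y_u_of_ne {a b a' b' : ℕ} (h : a ≠ a' ∨ b ≠ b') :
    form (yExp n a b) (uExp n a' b') = 0 := by
  have : (a, b) ≠ (a', b') := fun h' => by simp_all
  rw [form, yExp, uExp]
  split_ifs <;> simp [exponentForm_single, poisson, this]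

theorem form_y_u_of_not {a b : ℕ} (a' b' : ℕ) (h : ¬(1 ≤ a ∧ 1 ≤ b ∧ a + b ≤ n)) :
    form (yExp n a b) (uExp n a' b') = 0 := by
  rw [yExp, if_neg h, map_zero, LinearMap.zero_apply]

theorem form_g_left (a b : ℕ) (x : Param →₀ ℤ) : form (gExp n a b) x = 0 := by
  refine exponentForm_eq_zero (s := Set.range g) (t := Set.univ) ?_ ?_ (fun _ _ => trivial)
  · rintro _ ⟨p, rfl⟩ w -
    rfl
  · rw [gExp]
    split_ifs
    exacts [Finsupp.single_mem_supported ℤ 1 ⟨_, rfl⟩, zero_mem _]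

end Param

section LeftPoint

variable {K T : Type} [Field K] [Ring T] [Algebra K T] {n : ℕ} {η q : K}
  {C : AddMonoidAlgebra K (Param →₀ ℤ) →ₗ[K] T}

open Param

theorem isWeylPoint_diagMono_gExp (hC : IsWeylMap form η C) (hη : η ≠ 0)
    (hq : η ^ (2 * (n : ℤ) ^ 2) = q) (b : ℕ) (Q : Set (ℕ × ℕ)) :
    IsWeylPoint C q (subgroup Q) (diagMono K (edgeSum n fun a => gExp n a b)) := by
  have diagMono_eq : diagMono K (edgeSum n fun a => gExp n a b) =
      bidiagonal (n + 1) (fun i => .single (edgeSum n (fun a => gExp n a b) i) 1)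
        (.single 0 1) := by
    ext1 i j
    rw [diagMono, Matrix.diagonal_apply, bidiagonal, Matrix.of_apply,
      if_neg (c := _ ∧ _) (by omega)]
  have gExp_mem (a : ℕ) : gExp n a b ∈ subgroup Q := by
    rw [gExp]
    split_ifs
    exacts [single_mem_subgroup (v := .g (a, b)) trivial 1, zero_mem _]
  have edgeSum_apply (i : Fin n) : edgeSum n (fun a => gExp n a b) i =
      ∑ a ∈ Finset.range (n + 1), edgeWeight n a i • gExp n a b := by
    simp only [edgeSum, Finset.sum_apply, edgeExp]
  rw [diagMono_eq]
  refine isWeylPoint_bidiagonal hC hη form_isAlt _ _ _ (fun i => ?_) (zero_mem _) (fun i j => ?_)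
    ?_ hq fun i => ?_
  · rw [edgeSum_apply]
    exact sum_mem fun a _ => zsmul_mem (gExp_mem a) _
  · simp only [edgeSum_apply, map_sum, LinearMap.sum_apply, map_smul, LinearMap.smul_apply,
      form_g_left, smul_zero, Finset.sum_const_zero]
  · simp only [edgeSum_apply]
    rw [Finset.sum_comm]
    refine Finset.sum_eq_zero fun a ha => ?_
    rw [← Finset.sum_smul, sum_edgeWeight (Finset.mem_range_succ_iff.1 ha), zero_smul]
  · rw [if_neg (by omega), if_neg (by omega), map_zero, LinearMap.zero_apply, sub_zero, mul_zero]

theorem isWeylPoint_elementary (hC : IsWeylMap form η C) (hη : η ≠ 0)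
    (hq : η ^ (2 * (n : ℤ) ^ 2) = q) {a b : ℕ} (ha : 1 ≤ a) (hb : 1 ≤ b) (hab : a + b ≤ n) :
    IsWeylPoint C q (subgroup {(a, b)}) (elementary K n a (uExp n a b) (yExp n a b)) := by
  have hu : uExp n a b ∈ subgroup {(a, b)} := by
    rw [uExp, if_pos ⟨ha, hb, hab⟩]
    exact single_mem_subgroup rfl 1
  have hy : yExp n a b ∈ subgroup {(a, b)} := by
    rw [yExp, if_pos ⟨ha, hb, hab⟩]
    exact single_mem_subgroup rfl 1
  have sum_ite_eq_one (c : ℕ) (hc : c < n) :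
      ∑ i : Fin n, (if (i : ℕ) = c then (1 : ℤ) else 0) = 1 := by
    have hiff (i : Fin n) : (i : ℕ) = c ↔ i = ⟨c, hc⟩ := by rw [Fin.ext_iff]
    simp only [hiff, Finset.sum_ite_eq', Finset.mem_univ, if_true]
  have hpred (i : Fin n) : (i : ℕ) + 1 = a ↔ (i : ℕ) = a - 1 := by omega
  rw [elementary_eq_bidiagonal ha]
  refine isWeylPoint_bidiagonal hC hη form_isAlt _ _ _ (fun i => zsmul_mem hu _)
    (zsmul_mem (add_mem hy hu) _) (fun i j => ?_) ?_ hq fun i => ?_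
  · simp only [map_smul, LinearMap.smul_apply, form_u_u, smul_zero]
  · simp only [← Finset.sum_smul, ← Finset.mul_sum, Finset.sum_sub_distrib, hpred]
    rw [sum_ite_eq_one (a - 1) (by omega), sum_ite_eq_one a (by omega), sub_self, mul_zero,
      zero_smul]
  · simp only [map_smul, map_add, LinearMap.smul_apply, LinearMap.add_apply, form_u_u,
      form_y_u_self ⟨ha, hb, hab⟩, smul_eq_mul]
    ring

theorem isWeylPoint_block (hC : IsWeylMap form η C) (hη : η ≠ 0) (hq₀ : q ≠ 0)
    (hq : η ^ (2 * (n : ℤ) ^ 2) = q) {b : ℕ} (hb : b ∈ List.Ico 1 n) :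
    IsWeylPoint C q (subgroup {p | p.2 = b})
      (((List.Ico 1 (n - b + 1)).map fun a => elementary K n a (uExp n a b) (yExp n a b)).prod *
        diagMono K (edgeSum n fun a => gExp n a b)) := by
  have hb := List.Ico.mem.1 hb
  have elementary_prod := IsWeylPoint.list_prod hC form_isAlt hq₀ (fun a => subgroup {(a, b)})
    (fun a => elementary K n a (uExp n a b) (yExp n a b)) (List.Ico 1 (n - b + 1))
    (fun a ha => by
      have ha := List.Ico.mem.1 ha
      exact isWeylPoint_elementary hC hη hq ha.1 hb.1 (by omega))
    ((List.Ico.nodup 1 (n - b + 1)).imp fun h => form_eq_zero (by simpa using h))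
  refine (elementary_prod.mul hC form_isAlt hq₀ (S' := subgroup ∅) (fun x hx y hy => ?_)
    (isWeylPoint_diagMono_gExp hC hη hq b ∅)).mono ?_
  · exact form_eq_zero (Set.disjoint_empty Set.univ) x
      ((iSup₂_le fun a _ => subgroup_mono (Set.subset_univ _) : _ ≤ subgroup Set.univ) hx) y hy
  · exact sup_le (iSup₂_le fun a _ => subgroup_mono (by simp)) (subgroup_mono (by simp))

/-- The exponent of the coordinate at the vertex `(a, b, n - a - b)`. -/
def coordExp (n a b : ℕ) : Param →₀ ℤ := vertexExp (uExp n) (yExp n) (gExp n) a b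

theorem isBorelPoint_map_leftProduct_coordExp (hC : IsWeylMap form η C) (hη : η ≠ 0) (hq₀ : q ≠ 0)
    (hq : η ^ (2 * (n : ℤ) ^ 2) = q) :
    IsBorelPoint q ((leftProduct n fun a b _ => monomialUnit K (coordExp n a b)).map C) := by
  have blocks := IsWeylPoint.list_prod hC form_isAlt hq₀ (fun b => subgroup {p | p.2 = b}) _ _
    (fun b hb => isWeylPoint_block hC hη hq₀ hq hb)
    ((List.Ico.nodup 1 n).imp fun {b b'} h => form_eq_zero <|
      Set.disjoint_left.2 fun p hp hp' => h (hp.symm.trans hp'))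
  have all := (isWeylPoint_diagMono_gExp hC hη hq 0 ∅).mul hC form_isAlt hq₀
    (form_eq_zero (Set.empty_disjoint Set.univ))
    (blocks.mono (iSup₂_le fun b _ => subgroup_mono (Set.subset_univ _)))
  simp only [coordExp]
  rw [leftProduct_eq_prod_elementary]
  · exact all.isBorelPoint
  · exact fun a b h => if_neg (by omega)
  · exact fun a b h => if_neg (by omega)
  · exact fun a b h => if_neg (by omega)

end LeftPoint

/-! ### The Poisson matrix in canonical parameters -/

section Poisson

variable {n : ℕ}

open Param

theorem form_neg_swap (x y : Param →₀ ℤ) : -form x y = form y x := form_isAlt.neg x y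

theorem form_g_right (a b : ℕ) (x : Param →₀ ℤ) : form x (gExp n a b) = 0 := by
  rw [← form_neg_swap, form_g_left, neg_zero]

theorem form_coordExp (a b a' b' : ℕ) : form (coordExp n a b) (coordExp n a' b') =
    form (yExp n a b) (uExp n (a' + 1) b') - 2 * form (yExp n a b) (uExp n a' (b' + 1)) +
    form (yExp n a b) (uExp n (a' - 1) (b' + 1)) -
    form (yExp n a (b + 1)) (uExp n (a' + 1) b') +
    2 * form (yExp n a (b + 1)) (uExp n a' (b' + 1)) -
    form (yExp n a (b + 1)) (uExp n (a' - 1) (b' + 1)) -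
    (form (yExp n a' b') (uExp n (a + 1) b) - 2 * form (yExp n a' b') (uExp n a (b + 1)) +
    form (yExp n a' b') (uExp n (a - 1) (b + 1)) -
    form (yExp n a' (b' + 1)) (uExp n (a + 1) b) +
    2 * form (yExp n a' (b' + 1)) (uExp n a (b + 1)) -
    form (yExp n a' (b' + 1)) (uExp n (a - 1) (b + 1))) := by
  simp only [coordExp, vertexExp, map_add, map_sub, map_neg, map_smul, LinearMap.add_apply,
    LinearMap.sub_apply, LinearMap.neg_apply, LinearMap.smul_apply, form_u_u, form_y_y,
    form_g_left, form_g_right, ← form_neg_swap (yExp _ _ _) (uExp _ _ _), smul_eq_mul]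
  ring

theorem form_coordExp_horizontal {a b : ℕ} (ha : 1 ≤ a) (hb : 1 ≤ b) (h : a + 1 + b ≤ n) :
    form (coordExp n (a + 1) b) (coordExp n a b) = 2 := by
  rw [form_coordExp]
  simp (disch := omega) only [form_y_u_self, form_y_u_of_ne, Nat.add_sub_cancel]
  norm_num

theorem form_coordExp_bottom {a : ℕ} (ha : 1 ≤ a) (h : a + 1 ≤ n) :
    form (coordExp n (a + 1) 0) (coordExp n a 0) = 1 := by
  rw [form_coordExp]
  simp (disch := omega) only [form_y_u_self, form_y_u_of_ne, form_y_u_of_not, Nat.add_sub_cancel]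
  norm_num

theorem form_coordExp_vertical {a b : ℕ} (ha : 1 ≤ a) (h : a + b + 1 ≤ n) :
    form (coordExp n a b) (coordExp n a (b + 1)) = 2 := by
  rw [form_coordExp]
  simp (disch := omega) only [form_y_u_self, form_y_u_of_ne]
  norm_num

theorem form_coordExp_diagonal {a b : ℕ} (ha : 1 ≤ a) (h : a + 1 + b < n) :
    form (coordExp n a (b + 1)) (coordExp n (a + 1) b) = 2 := by
  rw [form_coordExp]
  simp (disch := omega) only [form_y_u_self, form_y_u_of_ne, Nat.add_sub_cancel]
  norm_num

theorem form_coordExp_side {a b : ℕ} (ha : 1 ≤ a) (h : a + 1 + b = n) :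
    form (coordExp n a (b + 1)) (coordExp n (a + 1) b) = 1 := by
  rw [form_coordExp]
  simp (disch := omega) only [form_y_u_self, form_y_u_of_ne, form_y_u_of_not, Nat.add_sub_cancel]
  norm_num

theorem form_coordExp_eq_zero {a b a' b' : ℕ} (ha : 1 ≤ a) (ha' : 1 ≤ a')
    (h₀ : a ≠ a' ∨ b ≠ b') (h₁ : a' + 1 ≠ a ∨ b' ≠ b) (h₂ : a' ≠ a ∨ b' ≠ b + 1)
    (h₃ : a' ≠ a + 1 ∨ b' + 1 ≠ b) (h₁' : a + 1 ≠ a' ∨ b ≠ b') (h₂' : a ≠ a' ∨ b ≠ b' + 1)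
    (h₃' : a ≠ a' + 1 ∨ b + 1 ≠ b') : form (coordExp n a b) (coordExp n a' b') = 0 := by
  rw [form_coordExp]
  simp (disch := omega) only [form_y_u_of_ne]
  norm_num

theorem poisson_of_arrow {v w : Vertex n} (h : Arrow v w) {r : ℤ}
    (h₁ : SameSide v w → r = 1) (h₂ : ¬SameSide v w → r = 2) : poisson n v w = r := by
  rw [poisson, if_pos h]
  split_ifs with hs
  · exact (h₁ hs).symm
  · exact (h₂ hs).symm

theorem poisson_eq_form_of_arrow {v w : Vertex n} (hv : v.a ≠ 0) (hw : w.a ≠ 0) (h : Arrow v w) :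
    poisson n v w = form (coordExp n v.a v.b) (coordExp n w.a w.b) := by
  obtain ⟨a, b, c, habc, _, _, _⟩ := v
  obtain ⟨a', b', c', habc', _, _, _⟩ := w
  refine poisson_of_arrow h (fun hs => ?_) fun hs => ?_
  all_goals
    simp only [SameSide, Arrow] at h hs hv hw ⊢
    rcases h with ⟨rfl, rfl, -⟩ | ⟨rfl, rfl, -⟩ | ⟨rfl, rfl, -⟩
  · obtain rfl : b' = 0 := by omega
    exact form_coordExp_bottom (by omega) (by omega)
  · omega
  · exact form_coordExp_side (by omega) (by omega)
  · exact form_coordExp_horizontal (by omega) (by omega) (by omega)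
  · exact form_coordExp_vertical (by omega) (by omega)
  · exact form_coordExp_diagonal (by omega) (by omega)

theorem poisson_eq_form {v w : Vertex n} (hv : v.a ≠ 0) (hw : w.a ≠ 0) :
    poisson n v w = form (coordExp n v.a v.b) (coordExp n w.a w.b) := by
  by_cases h : Arrow v w
  · exact poisson_eq_form_of_arrow hv hw h
  by_cases h' : Arrow w v
  · rw [poisson_antisymm, poisson_eq_form_of_arrow hw hv h', form_neg_swap]
  rw [poisson, if_neg h, if_neg h']
  obtain ⟨a, b, c, habc, _, _, _⟩ := v
  obtain ⟨a', b', c', habc', _, _, _⟩ := w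
  by_cases heq : a = a' ∧ b = b'
  · obtain ⟨rfl, rfl⟩ := heq
    exact (form_isAlt _).symm
  · simp only [Arrow] at h h' hv hw ⊢
    symm
    apply form_coordExp_eq_zero <;> grind only

/-- The reflection of the triangle exchanging the first and the last coordinate. -/
def reflect (v : Vertex n) : Vertex n where
  a := v.c
  b := v.b
  c := v.a
  sum_eq := by have := v.sum_eq; omega
  a_ne := v.c_ne
  b_ne := v.b_ne
  c_ne := v.a_ne

theorem poisson_reflect (v w : Vertex n) : poisson n (reflect v) (reflect w) = -poisson n v w := by
  have arrow_reflect (v w : Vertex n) : Arrow (reflect v) (reflect w) ↔ Arrow w v := by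
    simp only [Arrow, reflect]
    omega
  have sameSide_reflect : SameSide (reflect v) (reflect w) ↔ SameSide w v := by
    simp only [SameSide, reflect]
    omega
  rw [← poisson_antisymm]
  classical
  exact if_congr (arrow_reflect v w) (if_congr sameSide_reflect rfl rfl)
    (if_congr (arrow_reflect w v) (if_congr sameSide_reflect rfl rfl) rfl)

end Poisson

/-! ### The Fock–Goncharov coordinates -/

section Coordinates

variable {n : ℕ}

open Param

theorem coord_eq_monomialUnit (v : Vertex n) :
    coord n v.a v.b v.c = monomialUnit ℂ (.single v 1) := by
  rw [coord, dif_pos ⟨v.sum_eq, v.a_ne, v.b_ne, v.c_ne⟩]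
  exact Units.ext rfl

theorem exists_vertex {a b c : ℕ} (habc : a + b + c = n) (ha : 1 ≤ a) (han : a < n) :
    ∃ v : Vertex n, v.a = a ∧ v.b = b ∧ v.c = c :=
  ⟨⟨a, b, c, habc, by omega, by omega, by omega⟩, rfl, rfl, rfl⟩

theorem map_mapDomain_monomialUnit {K W W' : Type} [CommRing K] [AddCommGroup W] [AddCommGroup W']
    (κ : W →ₗ[ℤ] W') (w : W) :
    Units.map ((AddMonoidAlgebra.mapDomainRingHom K κ :
      AddMonoidAlgebra K W →+* AddMonoidAlgebra K W') :
      AddMonoidAlgebra K W →* AddMonoidAlgebra K W') (monomialUnit K w) = monomialUnit K (κ w) :=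
  Units.ext <| AddMonoidAlgebra.mapDomain_single

theorem map_mapDomain_coord {W : Type} [AddCommGroup W] (κ : (Vertex n →₀ ℤ) →ₗ[ℤ] W)
    (v : Vertex n) :
    Units.map ((AddMonoidAlgebra.mapDomainRingHom ℂ κ :
      Laurent (Vertex n) →+* AddMonoidAlgebra ℂ W) : Laurent (Vertex n) →* AddMonoidAlgebra ℂ W)
      (coord n v.a v.b v.c) = monomialUnit ℂ (κ (.single v 1)) := by
  rw [coord_eq_monomialUnit, map_mapDomain_monomialUnit]

/-- The exponents of the coordinates in terms of the canonical parameters. The coordinates on the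
side `a = 0` do not occur in the left matrix; they are sent to central parameters of their own, so
that the map is injective. -/
def paramMap (n : ℕ) : (Vertex n →₀ ℤ) →ₗ[ℤ] (Param →₀ ℤ) :=
  Finsupp.linearCombination ℤ fun v =>
    if v.a = 0 then gExp n 0 v.b else coordExp n v.a v.b

/-- The projection forgetting the coordinates on the side `a = 0`. -/
def leftMap (n : ℕ) : (Vertex n →₀ ℤ) →ₗ[ℤ] (Vertex n →₀ ℤ) :=
  Finsupp.linearCombination ℤ fun v => if v.a = 0 then 0 else .single v 1

/-- The map to the inverse coordinates at the reflected vertices, forgetting the coordinates on the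
side `a = 0`. -/
def rightMap (n : ℕ) : (Vertex n →₀ ℤ) →ₗ[ℤ] (Vertex n →₀ ℤ) :=
  Finsupp.linearCombination ℤ fun v => if v.a = 0 then 0 else .single (reflect v) (-1)

theorem coordExp_apply_g {a b a' b' : ℕ} (hab : a + b ≤ n) :
    coordExp n a b (.g (a', b')) = if (a, b) = (a', b') then 1 else 0 := by
  have uExp_apply (a b : ℕ) : uExp n a b (.g (a', b')) = 0 := by
    rw [uExp]
    split_ifs <;> simp
  have yExp_apply (a b : ℕ) : yExp n a b (.g (a', b')) = 0 := by
    rw [yExp]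
    split_ifs <;> simp
  classical
  simp [coordExp, vertexExp, uExp_apply, yExp_apply, gExp, hab, Finsupp.single_apply]

theorem paramMap_injective (n : ℕ) : Function.Injective (paramMap n) := by
  have coeff (v : Vertex n) :
      Finsupp.lapply (.g (v.a, v.b)) ∘ₗ paramMap n = Finsupp.lapply (R := ℤ) v := by
    ext w
    have eq_iff : (w.a, w.b) = (v.a, v.b) ↔ w = v := by
      obtain ⟨a, b, c, h, _, _, _⟩ := v
      obtain ⟨a', b', c', h', _, _, _⟩ := w
      simp only [Prod.mk.injEq, Vertex.mk.injEq]
      omega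
    have hw : w.a + w.b ≤ n := by have := w.sum_eq; omega
    classical
    simp only [LinearMap.comp_apply, Finsupp.lsingle_apply, Finsupp.lapply_apply, paramMap,
      Finsupp.linearCombination_single, one_smul, Finsupp.single_apply, ← eq_iff]
    rw [← coordExp_apply_g hw]
    split_ifs with ha
    · rw [coordExp_apply_g hw, gExp, if_pos (by omega), Finsupp.single_apply, ← ha]
      simp only [Param.g.injEq]
    · rfl
  intro m m' h
  ext v
  calc m v = paramMap n m (.g (v.a, v.b)) := (LinearMap.congr_fun (coeff v) m).symm
    _ = paramMap n m' (.g (v.a, v.b)) := by rw [h]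
    _ = m' v := LinearMap.congr_fun (coeff v) m'

theorem compl₁₂_leftMap : (exponentForm (poisson n)).compl₁₂ (leftMap n) (leftMap n) =
    form.compl₁₂ (paramMap n) (paramMap n) := by
  ext v w
  simp only [LinearMap.compl₁₂_apply, LinearMap.comp_apply, Finsupp.lsingle_apply, leftMap,
    paramMap, Finsupp.linearCombination_single, one_smul]
  split_ifs with hv hw hw
  · simp [form_g_left]
  · simp [form_g_left]
  · simp [form_g_right]
  · simp [exponentForm_single, poisson_eq_form hv hw]

theorem compl₁₂_rightMap : (-exponentForm (poisson n)).compl₁₂ (rightMap n) (rightMap n) =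
    form.compl₁₂ (paramMap n) (paramMap n) := by
  ext v w
  simp only [LinearMap.compl₁₂_apply, LinearMap.comp_apply, Finsupp.lsingle_apply, rightMap,
    paramMap, Finsupp.linearCombination_single, one_smul]
  split_ifs with hv hw hw
  · simp [form_g_left]
  · simp [form_g_left]
  · simp [form_g_right]
  · simp [exponentForm_single, poisson_reflect, poisson_eq_form hv hw]

theorem isBorelPoint_map_leftProduct_coord {T : Type} [Ring T] [Algebra ℂ T] {q η : ℂ}
    {C : Laurent (Vertex n) →ₗ[ℂ] T}
    (hC : IsWeylMap (form.compl₁₂ (paramMap n) (paramMap n)) η C) (hη : η ≠ 0) (hq₀ : q ≠ 0)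
    (hq : η ^ (2 * (n : ℤ) ^ 2) = q) :
    IsBorelPoint q ((leftProduct n (coord n)).map C) := by
  refine IsBorelPoint.of_twist_map hC (paramMap_injective n) ?_
  rw [leftProduct_map (x' := fun a b _ => monomialUnit ℂ (coordExp n a b))]
  · exact isBorelPoint_map_leftProduct_coordExp (isWeylMap_twist hη) hη hq₀ hq
  · intro a b c habc ha han
    obtain ⟨v, rfl, rfl, rfl⟩ := exists_vertex habc ha han
    rw [map_mapDomain_coord, paramMap, Finsupp.linearCombination_single, one_smul,
      if_neg (by omega)]

theorem isBorelPoint_quantumLeft {q ω η : ℂ} (hη : η ≠ 0) (hω : η ^ 2 = ω) (hq₀ : q ≠ 0)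
    (hq : η ^ (2 * (n : ℤ) ^ 2) = q) : IsBorelPoint q (quantumLeft n ω η) := by
  have hC := (isWeylMap_weyl (poisson_antisymm n) hη hω).comp_mapDomain (leftMap n)
  rw [compl₁₂_leftMap] at hC
  have borel := isBorelPoint_map_leftProduct_coord hC hη hq₀ hq
  have map_left : (leftProduct n (coord n)).map (AddMonoidAlgebra.mapDomainRingHom ℂ (leftMap n)) =
      leftProduct n (coord n) := by
    refine leftProduct_map _ fun a b c habc ha han => ?_
    obtain ⟨v, rfl, rfl, rfl⟩ := exists_vertex habc ha han
    rw [map_mapDomain_coord, leftMap, Finsupp.linearCombination_single, one_smul,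
      if_neg (by omega), coord_eq_monomialUnit]
  rw [quantumLeft, ← leftProduct, ← map_left]
  exact borel

theorem isSLPoint_quantumRight {q ω η : ℂ} (hη : η ≠ 0) (hω : η ^ 2 = ω) (hq₀ : q ≠ 0)
    (hq : η ^ (2 * (n : ℤ) ^ 2) = q) : IsSLPoint q (quantumRight n ω η) := by
  have hC := (isWeylMap_weyl (poisson_antisymm n) hη hω).neg.comp_mapDomain (rightMap n)
  rw [compl₁₂_rightMap] at hC
  have borel := isBorelPoint_map_leftProduct_coord hC (inv_ne_zero hη) (inv_ne_zero hq₀)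
    (by rw [inv_zpow, hq])
  have map_right :
      (leftProduct n (coord n)).map (AddMonoidAlgebra.mapDomainRingHom ℂ (rightMap n)) =
        leftProduct n fun a b c => (coord n c b a)⁻¹ := by
    refine leftProduct_map _ fun a b c habc ha han => ?_
    obtain ⟨v, rfl, rfl, rfl⟩ := exists_vertex habc ha han
    rw [map_mapDomain_coord, rightMap, Finsupp.linearCombination_single, one_smul,
      if_neg (by omega), Finsupp.single_neg, ← monomialUnit_inv, ← coord_eq_monomialUnit]
    rfl
  rw [quantumRight, ← rightProduct, rightProduct_eq_submatrix_rev, ← map_right]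
  exact borel.isSLPoint_submatrix_rev hq₀

end Coordinates

end FockGoncharov

end

theorem theorem1 (n : ℕ) (hn : 2 ≤ n) (q ω η : ℂ) (hq : q ≠ 0) (hω : ω ^ (n ^ 2) = q)
    (hη : η ^ 2 = ω) :
    FockGoncharov.IsSLPoint q (FockGoncharov.quantumLeft n ω η) ∧
    FockGoncharov.IsSLPoint q (FockGoncharov.quantumRight n ω η) ∧
    (∃! φ : FockGoncharov.SLq n q →ₐ[ℂ] FockGoncharov.FGTorus n ω,
      ∀ i j, φ (FockGoncharov.SLq.gen n q i j) = FockGoncharov.quantumLeft n ω η i j) ∧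
    (∃! φ : FockGoncharov.SLq n q →ₐ[ℂ] FockGoncharov.FGTorus n ω,
      ∀ i j, φ (FockGoncharov.SLq.gen n q i j) = FockGoncharov.quantumRight n ω η i j) := by
  have hη₀ : η ≠ 0 := by
    rintro rfl
    apply hq
    rw [← hω, ← hη, zero_pow two_ne_zero, zero_pow (by positivity)]
  have hq' : η ^ (2 * (n : ℤ) ^ 2) = q := by
    rw [← hω, ← hη, ← pow_mul]
    exact_mod_cast zpow_natCast η (2 * n ^ 2)
  have hL := (FockGoncharov.isBorelPoint_quantumLeft hη₀ hη hq hq').isSLPoint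
  have hR := FockGoncharov.isSLPoint_quantumRight hη₀ hη hq hq'
  exact ⟨hL, hR, hL.existsUnique_algHom, hR.existsUnique_algHom⟩
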